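/- For a real $n\times n$ matrix $B=(b_{i,j})$ put $\mathrm{off}(B)=\big(\sum_{i}\sum_{j\ne i}b_{i,j}^2\big)^{1/2}$ and $\mathrm{off}(B(m,:))=\big(\sum_{j\ne m}b_{m,j}^2\big)^{1/2}$. Algorithm 1, with input a symmetric $A\in\mathbb R^{n\times n}$, a tolerance $tol\ge 0$ and an index $m\in\{1,\dots,n\}$, first permutes the rows and columns of $A$ symmetrically so that the diagonal entries are in increasing order (stable sort); the result is $A^{(0)}$. It then repeats cycles of $n-1$ steps. In the steps of a cycle, $k$ runs through $1,2,\dots,m-1$ and then through $n,n-1,\dots,m+1$. In the step with index $k$, let $p=\min\{k,m\}$, $q=\max\{k,m\}$ and let $A$ denote the current matrix. If $|a_{m,k}|\ge tol$, compute a Schur decomposition $A([p,q],[p,q])=UTU^T$ with $U\in\mathbb R^{2\times2}$ orthogonal and $T$ diagonal, interchange the two columns of $U$ if $t_{1,1}>t_{2,2}$, and replace $A([p,q],:)$ by $U^TA([p,q],:)$ and then $A(:,[p,q])$ by $A(:,[p,q])U$; if $|a_{m,k}|<tol$, leave $A$ unchanged. Let $A^{(k)}$ be the matrix after $k$ steps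 in total (so $A^{(\ell(n-1))}$ is the matrix after $\ell$ cycles), $D_k=\mathrm{diag}(A^{(k)})$, $H^{(k)}=|D_k|^{-1/2}A^{(k)}|D_k|^{-1/2}$ when $D_k$ is invertible, and $\alpha_k=\mathrm{off}(H^{(k)})$. **Theorem 2.** Let $n\ge 3$ and let $A=(a_{i,j})\in\mathbb R^{n\times n}$ be symmetric with $a_{1,1}\le a_{2,2}\le\dots\le a_{n,n}$ and $a_{i,i}\ne0$ for all $i$ (so that $A^{(0)}=A$). Let $\lambda_1,\dots,\lambda_n$ be the eigenvalues of $A$, listed with multiplicity, and let $$\gamma=\min_{1\le j\le n}\ \min_{i\ne j}\frac{|\lambda_i-\lambda_j|}{|\lambda_i|+|\lambda_j|}$$ be the minimum relative gap (a quotient $0/0$ is read as $0$). Assume that $\alpha_0\le\frac1{11}\min\{\frac1n,\gamma\}$. Let $m\in\{1,\dots,n\}$ and let $A^{(k)}$, $0\le k\le n(n-1)$, be the matrices generated in the first $n$ cycles of Algorithm 1 applied to $A$ with $tol=0$ and index $m$, whatever Schur decompositions are chosen in the steps. Then: 1. for $0\le k\le n(n-1)$ all diagonal entries of $A^{(k)}$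 are nonzero (so that $H^{(k)}$ is defined), and $\alpha_k\le 1.001\,\alpha_0$; 2. for $1\le\ell\le n$, $$\mathrm{off}\big(H^{((n-1)\ell)}(m,:)\big)\le\Big(\frac{2.8\cdot1.001\,\alpha_0}{\gamma}\Big)^{\ell}\alpha_0 .$$ (If $\gamma=0$, then the assumption forces $\alpha_0=0$, and the right-hand side in 2 is read as $0$.) -/

import Mathlib

namespace PartialJacobi

open Matrix

/-- `off(A)`, the Frobenius norm of the off-diagonal part of a square matrix. -/
noncomputable def off {n : ℕ} (A : Matrix (Fin n) (Fin n) ℝ) : ℝ :=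
  √(∑ i, ∑ j with j ≠ i, A i j ^ 2)

/-- `off(A(k,:))`, the Euclidean norm of the off-diagonal part of the row `k`. -/
noncomputable def offRow {n : ℕ} (A : Matrix (Fin n) (Fin n) ℝ) (k : Fin n) : ℝ :=
  √(∑ j with j ≠ k, A k j ^ 2)

/-- The scaled matrix `H = |D|^(-1/2) A |D|^(-1/2)` with `D = diag(A)`
(meaningful when all diagonal entries of `A` are nonzero). -/
noncomputable def scaled {n : ℕ} (A : Matrix (Fin n) (Fin n) ℝ) : Matrix (Fin n) (Fin n) ℝ :=
  Matrix.diagonal (fun i => (√|A i i|)⁻¹) * A * Matrix.diagonal (fun i => (√|A i i|)⁻¹)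

/-- The minimum relative gap in the spectrum of a real symmetric matrix: the minimum over `j`
and `i ≠ j` of `|λ_i - λ_j| / (|λ_i| + |λ_j|)`, the eigenvalues being listed with multiplicity
(it is used for order at least two, when the minimum is over a nonempty finite set). -/
noncomputable def relGap {n : ℕ} {A : Matrix (Fin n) (Fin n) ℝ} (hA : A.IsHermitian) : ℝ :=
  ⨅ j : Fin n, ⨅ i : {i : Fin n // i ≠ j},
    |hA.eigenvalues i - hA.eigenvalues j| / (|hA.eigenvalues i| + |hA.eigenvalues j|)

/-- `(U, T)` is a possible output of `schur(B)` for a symmetric matrix `B` of order two. -/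
def IsSchur (B U T : Matrix (Fin 2) (Fin 2) ℝ) : Prop :=
  U ∈ Matrix.orthogonalGroup (Fin 2) ℝ ∧ T.IsDiag ∧ B = U * T * Uᵀ

/-- If `T(1,1) > T(2,2)`, interchange the two columns of `U`. -/
noncomputable def orderCols (U T : Matrix (Fin 2) (Fin 2) ℝ) : Matrix (Fin 2) (Fin 2) ℝ :=
  if T 0 0 > T 1 1 then U.submatrix id ![1, 0] else U

/-- The assignment `A([p,q],:) = V A([p,q],:)`. -/
def updateRows {n : ℕ} (p q : Fin n) (V : Matrix (Fin 2) (Fin 2) ℝ)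
    (A : Matrix (Fin n) (Fin n) ℝ) : Matrix (Fin n) (Fin n) ℝ :=
  Matrix.of fun i j =>
    if i = p then (V * A.submatrix ![p, q] id) 0 j
    else if i = q then (V * A.submatrix ![p, q] id) 1 j
    else A i j

/-- The assignment `A(:,[p,q]) = A(:,[p,q]) V`. -/
def updateCols {n : ℕ} (p q : Fin n) (V : Matrix (Fin 2) (Fin 2) ℝ)
    (A : Matrix (Fin n) (Fin n) ℝ) : Matrix (Fin n) (Fin n) ℝ :=
  Matrix.of fun i j =>
    if j = p then (A.submatrix id ![p, q] * V) i 0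
    else if j = q then (A.submatrix id ![p, q] * V) i 1
    else A i j

/-- `A'` is a possible result of the body of the `for` loops, run on `A` with the index `k ≠ m`.
The plane is `[k,m]` for `k < m` and `[m,k]` for `k > m`, that is `[min, max]` in both loops. -/
def Step {n : ℕ} (tol : ℝ) (m k : Fin n) (A A' : Matrix (Fin n) (Fin n) ℝ) : Prop :=
  (tol ≤ |A m k| →
    ∃ U T : Matrix (Fin 2) (Fin 2) ℝ,
      IsSchur (A.submatrix ![min k m, max k m] ![min k m, max k m]) U T ∧
      A' = updateCols (min k m) (max k m) (orderCols U T)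
            (updateRows (min k m) (max k m) (orderCols U T)ᵀ A)) ∧
  (|A m k| < tol → A' = A)

/-- The index `k` used in the step `t = 0, …, n - 2` of a cycle. With indices starting from zero,
`k` runs through `0, 1, …, m - 1` and then through `n - 1, n - 2, …, m + 1`. -/
def pivot {n : ℕ} (m : Fin n) (t : ℕ) : Fin n :=
  ⟨if t < (m : ℕ) then t else n - 1 - (t - (m : ℕ)), by
    have := m.isLt
    split_ifs <;> omega⟩

/-- The preprocessing `[ignore, p] = sort(diag(A)); A = A(p,p)` (a stable sort). -/
noncomputable def sortDiag {n : ℕ} (A : Matrix (Fin n) (Fin n) ℝ) : Matrix (Fin n) (Fin n) ℝ :=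
  A.submatrix (Tuple.sort fun i => A i i) (Tuple.sort fun i => A i i)

/-- `X 0, X 1, …, X (L * (n - 1))` are the matrices generated by the algorithm, with tolerance
`tol` and index `m`, in the first `L` cycles of the `while` statement when it is applied to `A`. -/
def IsRun {n : ℕ} (tol : ℝ) (m : Fin n) (A : Matrix (Fin n) (Fin n) ℝ) (L : ℕ)
    (X : ℕ → Matrix (Fin n) (Fin n) ℝ) : Prop :=
  X 0 = sortDiag A ∧
    ∀ k < L * (n - 1), Step tol m (pivot m (k % (n - 1))) (X k) (X (k + 1))

end PartialJacobi

namespace PartialJacobi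

open Matrix

/-! Let h be the scaled pivot, S the squared off-norm of the scaled matrix, γ the relative gap of
the spectrum and g = 0.87γ. Two estimates carry the theorem.

Growth. When a_mm and a_kk are in order, the ordered Schur form moves them apart, and its sine
satisfies |s||a_mm − a_kk| ≤ |a_mk|. In scaled coordinates every surplus term created by the
rotation carries the factor |a_kk| − |a_mm|, so the mixed terms are bounded by h with no 1/g. S thus
gains about (h + 2h²/g)S, while annihilating the pivot removes 2h²; completing the square gives S' ≤
S + S²/5 (`IsRotated.offSq_scaled_le`). Since nα₀ ≤ 1/11, the n(n − 1) steps together change S by a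
fraction of a percent. The separation used here is available at each step because the diagonal
entries are relative perturbations of the eigenvalues (`exists_perm_abs_sub_le`), so they inherit
the gap (`gap_diag`). It also keeps a_mm in its sorted place (`IsRotated.lt_diag_of_lt`).

Contraction. Within a cycle, an annihilated entry of row m is refilled only by later pivots, each
multiplied by 1/g and by an off-diagonal coupling of size at most about β = 1.001α₀. Hence the row
shrinks by a factor of order β/g per cycle: `sweep_bound` is the abstract recurrence and
`offRow_sweep_le` its application. -/

/-! ### One step of the algorithm as a plane rotation. -/

/-- The orthogonal matrix acting as `W` in the plane `(p, q)`. -/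
noncomputable def planeMatrix {n : ℕ} (p q : Fin n) (W : Matrix (Fin 2) (Fin 2) ℝ) :
    Matrix (Fin n) (Fin n) ℝ :=
  updateCols p q W 1

lemma updateCols_eq_mul {n : ℕ} {p q : Fin n} (W : Matrix (Fin 2) (Fin 2) ℝ)
    (M : Matrix (Fin n) (Fin n) ℝ) : updateCols p q W M = M * planeMatrix p q W := by
  ext i j
  have h (i l : Fin n) : ∑ x, M i x * (1 : Matrix (Fin n) (Fin n) ℝ) x l = M i l :=
    congrFun (congrFun (Matrix.mul_one M) i) l
  simp only [planeMatrix, updateCols, Matrix.of_apply, Matrix.mul_apply, Fin.sum_univ_two,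
    Matrix.submatrix_apply, id, Matrix.cons_val_zero, Matrix.cons_val_one,
    Matrix.cons_val_fin_one]
  split_ifs
  · simp only [mul_add, Finset.sum_add_distrib, ← mul_assoc, ← Finset.sum_mul]
    exact congrArg₂ (fun x y => x * W 0 0 + y * W 1 0) (h i p).symm (h i q).symm
  · simp only [mul_add, Finset.sum_add_distrib, ← mul_assoc, ← Finset.sum_mul]
    exact congrArg₂ (fun x y => x * W 0 1 + y * W 1 1) (h i p).symm (h i q).symm
  · rw [h]

lemma updateRows_eq_mul {n : ℕ} {p q : Fin n} (W : Matrix (Fin 2) (Fin 2) ℝ)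
    (M : Matrix (Fin n) (Fin n) ℝ) : updateRows p q Wᵀ M = (planeMatrix p q W)ᵀ * M := by
  have h : updateRows p q Wᵀ M = (updateCols p q W Mᵀ)ᵀ := by
    ext i j
    simp only [updateRows, updateCols, Matrix.of_apply, Matrix.transpose_apply, Matrix.mul_apply,
      Fin.sum_univ_two, Matrix.submatrix_apply, id, Matrix.cons_val_zero, Matrix.cons_val_one,
      Matrix.cons_val_fin_one]
    split_ifs <;> ring
  rw [h, updateCols_eq_mul, Matrix.transpose_mul, Matrix.transpose_transpose]

lemma planeMatrix_orthogonal {n : ℕ} {p q : Fin n} (hpq : p ≠ q) {W : Matrix (Fin 2) (Fin 2) ℝ}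
    (hW : Wᵀ * W = 1) : (planeMatrix p q W)ᵀ * planeMatrix p q W = 1 := by
  have h00 := congrFun (congrFun hW 0) 0
  have h01 := congrFun (congrFun hW 0) 1
  have h11 := congrFun (congrFun hW 1) 1
  simp [Matrix.mul_apply] at h00 h01 h11
  rw [← updateCols_eq_mul]
  ext i j
  simp only [planeMatrix, updateCols, Matrix.of_apply, Matrix.mul_apply, Fin.sum_univ_two,
    Matrix.submatrix_apply, Matrix.transpose_apply, id, Matrix.cons_val_zero, Matrix.cons_val_one,
    Matrix.cons_val_fin_one, Matrix.one_apply, hpq, hpq.symm, if_true, if_false]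
  by_cases h1 : i = p
  · subst h1
    by_cases h3 : j = i
    · subst h3; simp; linarith
    by_cases h4 : j = q
    · subst h4; simp [hpq, hpq.symm]; linarith
    · simp [h3, h4, Ne.symm h3]
  by_cases h2 : i = q
  · subst h2
    by_cases h3 : j = p
    · subst h3; simp [hpq.symm]; linarith
    by_cases h4 : j = i
    · subst h4; simp [hpq.symm]; linarith
    · simp [h3, h4, Ne.symm h4, hpq.symm]
  by_cases h3 : j = p
  · subst h3; simp [h1, h2, Ne.symm h1, Ne.symm h2]
  by_cases h4 : j = q
  · subst h4; simp [h1, h2, Ne.symm h1, Ne.symm h2, h3]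
  · simp [h1, h2, h3, h4, eq_comm]

/-- `A'` arises from `A` by a rotation in the plane `(m, k)` that annihilates the entry `(m, k)`
and moves the two diagonal entries apart by `e` each. -/
structure IsRotated {n : ℕ} (m k : Fin n) (A A' : Matrix (Fin n) (Fin n) ℝ)
    (c s c' s' e : ℝ) : Prop where
  symm : ∀ i j, A' i j = A' j i
  sq_add_sq : c ^ 2 + s ^ 2 = 1
  cos_sq : c' ^ 2 = c ^ 2
  sin_sq : s' ^ 2 = s ^ 2
  ortho : c * s + c' * s' = 0
  row_m : ∀ j, j ≠ m → j ≠ k → A' m j = c * A m j + s * A k j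
  row_k : ∀ j, j ≠ m → j ≠ k → A' k j = c' * A k j + s' * A m j
  pivot_eq_zero : A' m k = 0
  rest : ∀ i j, i ≠ m → i ≠ k → j ≠ m → j ≠ k → A' i j = A i j
  sin_le : |s| * |A m m - A k k| ≤ |A m k|
  shift_nonneg : 0 ≤ e
  shift_le : e * |A m m - A k k| ≤ A m k ^ 2
  shift_eq_zero : A m k = 0 → e = 0
  diag_of_lt : k < m → A' m m = A m m + e ∧ A' k k = A k k - e
  diag_of_gt : m < k → A' m m = A m m - e ∧ A' k k = A k k + e
  similar : ∃ Q : Matrix (Fin n) (Fin n) ℝ, Qᵀ * Q = 1 ∧ A' = Qᵀ * A * Q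

lemma orderCols_spec {B U T : Matrix (Fin 2) (Fin 2) ℝ} (h : IsSchur B U T) :
    (orderCols U T)ᵀ * orderCols U T = 1 ∧ ∃ d₁ d₂ : ℝ, d₁ ≤ d₂ ∧
      B = orderCols U T * Matrix.diagonal ![d₁, d₂] * (orderCols U T)ᵀ := by
  obtain ⟨hU, hT, hB⟩ := h
  have hU' : Uᵀ * U = 1 := by
    have := (Matrix.mem_orthogonalGroup_iff' (Fin 2) ℝ).1 hU
    simpa [Matrix.star_eq_conjTranspose] using this
  have hT01 : T 0 1 = 0 := hT (by decide)
  have hT10 : T 1 0 = 0 := hT (by decide)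
  have h00 := congrFun (congrFun hU' 0) 0
  have h01 := congrFun (congrFun hU' 0) 1
  have h10 := congrFun (congrFun hU' 1) 0
  have h11 := congrFun (congrFun hU' 1) 1
  simp [Matrix.mul_apply] at h00 h01 h10 h11
  unfold orderCols
  split_ifs with hlt
  · refine ⟨?_, T 1 1, T 0 0, hlt.le, ?_⟩
    · ext i j
      simp only [Matrix.mul_apply, Fin.sum_univ_two, Matrix.submatrix_apply,
        Matrix.transpose_apply, id]
      fin_cases i <;> fin_cases j <;> simp [h00, h01, h10, h11]
    · rw [hB]
      ext i j
      simp only [Matrix.mul_apply, Fin.sum_univ_two, Matrix.submatrix_apply,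
        Matrix.transpose_apply, id, Matrix.diagonal, Matrix.of_apply]
      fin_cases i <;> fin_cases j <;> simp [hT01, hT10] <;> ring
  · refine ⟨hU', T 0 0, T 1 1, not_lt.1 hlt, ?_⟩
    rw [hB]
    ext i j
    fin_cases i <;> fin_cases j <;>
      simp [Matrix.mul_apply, Matrix.diagonal, hT01, hT10]

/-- The estimates for the rotation that diagonalises `!![a, x; x, b]` with `a ≤ b`, where
`c`, `s` are its cosine and sine and `D` is the distance of the eigenvalues. -/
lemma rotation_bounds {a b x c s D : ℝ} (hD : 0 ≤ D) (hab : a ≤ b) (hcs : c ^ 2 + s ^ 2 = 1)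
    (hdiff : b - a = (c ^ 2 - s ^ 2) * D) (hx : x ^ 2 = (c * s * D) ^ 2) :
    |s| * |b - a| ≤ |x| ∧ s ^ 2 * D * |b - a| ≤ x ^ 2 ∧ (x = 0 → s ^ 2 * D = 0) := by
  have h0 : 0 ≤ b - a := by linarith
  have hc1 : |c| ≤ 1 := by
    rw [← sq_le_one_iff_abs_le_one]; nlinarith [sq_nonneg s]
  have hx' : |x| = |c| * |s| * D := by
    rw [sq_eq_sq_iff_abs_eq_abs] at hx
    rw [hx, abs_mul, abs_mul, abs_of_nonneg hD]
  rw [abs_of_nonneg h0]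
  refine ⟨?_, ?_, ?_⟩
  · rw [hx', hdiff]
    have h2 : c ^ 2 - s ^ 2 ≤ |c| := by
      nlinarith [sq_abs c, abs_nonneg c, sq_nonneg s]
    calc |s| * ((c ^ 2 - s ^ 2) * D) = (c ^ 2 - s ^ 2) * (|s| * D) := by ring
      _ ≤ |c| * (|s| * D) := mul_le_mul_of_nonneg_right h2 (by positivity)
      _ = _ := by ring
  · rw [hx, hdiff]
    have : 0 ≤ s ^ 2 * s ^ 2 * D ^ 2 := by positivity
    nlinarith
  · intro h
    rw [h] at hx
    have h3 : c * s * D = 0 := by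
      have : (c * s * D) ^ 2 = 0 := by rw [← hx]; norm_num
      exact pow_eq_zero_iff (two_ne_zero) |>.1 this
    rcases mul_eq_zero.1 h3 with h4 | h4
    · rcases mul_eq_zero.1 h4 with h5 | h5
      -- If c = 0 then b − a = −D, so a ≤ b forces D = 0: a genuine interchange of the diagonal
      -- entries cannot occur.
      · rw [h5] at hdiff hcs
        have : s ^ 2 = 1 := by linarith
        rw [this] at hdiff ⊢
        nlinarith
      · rw [h5]; ring
    · rw [h4]; ring

/-- The Schur factor may have determinant −1, so the coefficients of the two rows agree only up to
sign; hence the separate c', s'. Both orientations are needed because m can be either end of the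
plane. -/
lemma exists_isRotated_of_diagonalizes {n : ℕ} {p q : Fin n} (hpq : p < q)
    {A : Matrix (Fin n) (Fin n) ℝ} (hA : ∀ i j, A i j = A j i) (hle : A p p ≤ A q q)
    {W : Matrix (Fin 2) (Fin 2) ℝ} (hW : Wᵀ * W = 1) {d₁ d₂ : ℝ} (hd : d₁ ≤ d₂)
    (hB : A.submatrix ![p, q] ![p, q] = W * Matrix.diagonal ![d₁, d₂] * Wᵀ) :
    let A' := updateCols p q W (updateRows p q Wᵀ A)
    (∃ c s c' s' e, IsRotated p q A A' c s c' s' e) ∧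
      ∃ c s c' s' e, IsRotated q p A A' c s c' s' e := by
  intro A'
  have hne : p ≠ q := hpq.ne
  have hW' : W * Wᵀ = 1 := mul_eq_one_comm.1 hW
  have hA' : A' = (planeMatrix p q W)ᵀ * A * planeMatrix p q W := by
    simp only [A']; rw [updateCols_eq_mul, updateRows_eq_mul]
  have hQ := planeMatrix_orthogonal hne hW
  have c00 := congrFun (congrFun hW 0) 0
  have c01 := congrFun (congrFun hW 0) 1
  have c11 := congrFun (congrFun hW 1) 1
  have r00 := congrFun (congrFun hW' 0) 0
  have r01 := congrFun (congrFun hW' 0) 1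
  have r11 := congrFun (congrFun hW' 1) 1
  have b00 := congrFun (congrFun hB 0) 0
  have b01 := congrFun (congrFun hB 0) 1
  have b10 := congrFun (congrFun hB 1) 0
  have b11 := congrFun (congrFun hB 1) 1
  simp [Matrix.mul_apply] at c00 c01 c11 r00 r01 r11
  simp [Matrix.mul_apply, Matrix.diagonal] at b00 b01 b10 b11
  have hsymm : ∀ i j, A' i j = A' j i := by
    have hAt : Aᵀ = A := by ext i j; exact hA j i
    have : A'ᵀ = A' := by
      rw [hA']; simp [Matrix.transpose_mul, hAt, Matrix.mul_assoc]
    intro i j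
    exact congrFun (congrFun this j) i
  have hp : ∀ j, j ≠ p → j ≠ q → A' p j = W 0 0 * A p j + W 1 0 * A q j := by
    intro j h1 h2
    simp only [A', updateCols, updateRows, Matrix.of_apply, Matrix.mul_apply, Fin.sum_univ_two,
      Matrix.submatrix_apply, if_true, Matrix.transpose_apply, id, Matrix.cons_val_zero,
      Matrix.cons_val_one, h1, h2, if_false, Matrix.cons_val_fin_one]
  have hq : ∀ j, j ≠ p → j ≠ q → A' q j = W 0 1 * A p j + W 1 1 * A q j := by
    intro j h1 h2
    simp only [A', updateCols, updateRows, Matrix.of_apply, Matrix.mul_apply, Fin.sum_univ_two,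
      Matrix.submatrix_apply, if_true, Matrix.transpose_apply, id, Matrix.cons_val_zero,
      Matrix.cons_val_one, h1, h2, hne.symm, if_false, Matrix.cons_val_fin_one]
  have hrest : ∀ i j, i ≠ p → i ≠ q → j ≠ p → j ≠ q → A' i j = A i j := by
    intro i j h1 h2 h3 h4
    simp [A', updateCols, updateRows, h1, h2, h3, h4]
  have e1 : W 0 0 ^ 2 = W 1 1 ^ 2 := by linear_combination c00 - r11
  have e2 : W 0 1 ^ 2 = W 1 0 ^ 2 := by linear_combination r00 - c00
  have hpp : A' p p = d₁ := by
    simp only [A', updateCols, updateRows, Matrix.of_apply, Matrix.mul_apply, Fin.sum_univ_two,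
      Matrix.submatrix_apply, if_true, Matrix.transpose_apply, id, Matrix.cons_val_zero,
      Matrix.cons_val_one, Matrix.cons_val_fin_one]
    rw [b00, b01, b10, b11]
    linear_combination (d₁ * (W 0 0 * W 0 0 + W 1 0 * W 1 0 + 1)) * c00 +
      (d₂ * (W 0 0 * W 0 1 + W 1 0 * W 1 1)) * c01
  have hqq : A' q q = d₂ := by
    simp only [A', updateCols, updateRows, Matrix.of_apply, Matrix.mul_apply, Fin.sum_univ_two,
      Matrix.submatrix_apply, if_true, Matrix.transpose_apply, id, Matrix.cons_val_zero,
      Matrix.cons_val_one, hne.symm, if_false, Matrix.cons_val_fin_one]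
    rw [b00, b01, b10, b11]
    linear_combination (d₂ * (W 0 1 * W 0 1 + W 1 1 * W 1 1 + 1)) * c11 +
      (d₁ * (W 0 0 * W 0 1 + W 1 0 * W 1 1)) * c01
  have hpq0 : A' p q = 0 := by
    simp only [A', updateCols, updateRows, Matrix.of_apply, Matrix.mul_apply, Fin.sum_univ_two,
      Matrix.submatrix_apply, if_true, Matrix.transpose_apply, id, Matrix.cons_val_zero,
      Matrix.cons_val_one, hne.symm, if_false, Matrix.cons_val_fin_one]
    rw [b00, b01, b10, b11]
    linear_combination (d₁ * (W 0 0 * W 0 1 + W 1 0 * W 1 1)) * c00 +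
      (d₁ + d₂ * (W 0 1 * W 0 1 + W 1 1 * W 1 1)) * c01
  have hcs : W 0 0 ^ 2 + W 1 0 ^ 2 = 1 := by linear_combination c00
  have hdiff : A q q - A p p = (W 0 0 ^ 2 - W 1 0 ^ 2) * (d₂ - d₁) := by
    rw [b00, b11]; linear_combination (-d₂) * e1 - d₂ * e2
  have hx : A p q ^ 2 = (W 0 0 * W 1 0 * (d₂ - d₁)) ^ 2 := by
    have : A p q = -(W 0 0 * W 1 0 * (d₂ - d₁)) := by
      rw [b01]; linear_combination d₂ * r01
    rw [this]; ring
  obtain ⟨k1, k2, k3⟩ := rotation_bounds (sub_nonneg.2 hd) hle hcs hdiff hx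
  have hdp : A' p p = A p p - W 1 0 ^ 2 * (d₂ - d₁) := by
    rw [hpp, b00]; linear_combination (-d₁) * hcs + (-d₂) * e2
  have hdq : A' q q = A q q + W 1 0 ^ 2 * (d₂ - d₁) := by
    rw [hqq, b11]; linear_combination (-d₂) * r11
  have he : 0 ≤ W 1 0 ^ 2 * (d₂ - d₁) := mul_nonneg (sq_nonneg _) (sub_nonneg.2 hd)
  have hs : |W 0 1| = |W 1 0| := (sq_eq_sq_iff_abs_eq_abs _ _).1 e2
  refine ⟨⟨W 0 0, W 1 0, W 1 1, W 0 1, W 1 0 ^ 2 * (d₂ - d₁), ?_⟩,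
    ⟨W 1 1, W 0 1, W 0 0, W 1 0, W 1 0 ^ 2 * (d₂ - d₁), ?_⟩⟩
  · exact
    { symm := hsymm
      sq_add_sq := hcs
      cos_sq := e1.symm
      sin_sq := e2
      ortho := by linear_combination r01
      row_m := hp
      row_k := fun j h1 h2 => by rw [hq j h1 h2]; ring
      pivot_eq_zero := hpq0
      rest := hrest
      sin_le := by rw [abs_sub_comm]; exact k1
      shift_nonneg := he
      shift_le := by rw [abs_sub_comm]; exact k2
      shift_eq_zero := k3
      diag_of_lt := fun h => absurd h (lt_asymm hpq)
      diag_of_gt := fun _ => ⟨hdp, hdq⟩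
      similar := ⟨_, hQ, hA'⟩ }
  · exact
    { symm := hsymm
      sq_add_sq := by linear_combination r11 + e2
      cos_sq := e1
      sin_sq := e2.symm
      ortho := by linear_combination r01
      row_m := fun j h1 h2 => by rw [hq j h2 h1]; ring
      row_k := fun j h1 h2 => hp j h2 h1
      pivot_eq_zero := by rw [hsymm]; exact hpq0
      rest := fun i j h1 h2 h3 h4 => hrest i j h2 h1 h4 h3
      sin_le := by rw [hs, hA q p]; exact k1
      shift_nonneg := he
      shift_le := by rw [hA q p]; exact k2
      shift_eq_zero := by rw [hA q p]; exact k3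
      diag_of_lt := fun _ => ⟨hdq, hdp⟩
      diag_of_gt := fun h => absurd h (lt_asymm hpq)
      similar := ⟨_, hQ, hA'⟩ }

/-- With tolerance 0 a rotation is always performed. The order hypotheses make the ordered columns
of the Schur factor describe the small rotation instead of one close to an interchange. -/
lemma Step.exists_isRotated {n : ℕ} {m k : Fin n} {A A' : Matrix (Fin n) (Fin n) ℝ}
    (hstep : Step 0 m k A A') (hmk : k ≠ m) (hA : ∀ i j, A i j = A j i)
    (hlt : k < m → A k k ≤ A m m) (hgt : m < k → A m m ≤ A k k) :
    ∃ c s c' s' e, IsRotated m k A A' c s c' s' e := by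
  obtain ⟨U, T, hS, rfl⟩ := hstep.1 (abs_nonneg _)
  rcases lt_or_gt_of_ne hmk with h | h
  · rw [min_eq_left h.le, max_eq_right h.le] at hS ⊢
    obtain ⟨hW, d₁, d₂, hd, hB⟩ := orderCols_spec hS
    exact (exists_isRotated_of_diagonalizes h hA (hlt h) hW hd hB).2
  · rw [min_eq_right h.le, max_eq_left h.le] at hS ⊢
    obtain ⟨hW, d₁, d₂, hd, hB⟩ := orderCols_spec hS
    exact (exists_isRotated_of_diagonalizes h hA (hgt h) hW hd hB).1

/-! ### Diagonal entries as relative perturbations of the eigenvalues. -/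

lemma sum_mulVec_sq {n : ℕ} {V : Matrix (Fin n) (Fin n) ℝ} (hV : Vᵀ * V = 1) (x : Fin n → ℝ) :
    ∑ j, (V *ᵥ x) j ^ 2 = ∑ j, x j ^ 2 := by
  have h : (V *ᵥ x) ⬝ᵥ (V *ᵥ x) = x ⬝ᵥ x := by
    rw [Matrix.dotProduct_mulVec, ← Matrix.mulVec_transpose, Matrix.mulVec_mulVec, hV,
      Matrix.one_mulVec]
  simpa [dotProduct, sq] using h

/-- Monotonicity of the ordered eigenvalues in the Loewner order, for quadratic forms given in
diagonalised form. -/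
lemma eigenvalue_le_of_form_le {n : ℕ} {V W : Matrix (Fin n) (Fin n) ℝ} (hV : Vᵀ * V = 1)
    (hW : Wᵀ * W = 1) {a b : Fin n → ℝ} {σ τ : Equiv.Perm (Fin n)} (ha : Monotone (a ∘ σ))
    (hb : Monotone (b ∘ τ))
    (hle : ∀ x : Fin n → ℝ, ∑ j, a j * (V *ᵥ x) j ^ 2 ≤ ∑ j, b j * (W *ᵥ x) j ^ 2) (i : Fin n) :
    a (σ i) ≤ b (τ i) := by
  -- Courant–Fischer by dimension count: n − 1 linear conditions kill the coordinates of the first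
  -- form below i and those of the second above i. A nonzero x remains, and on it the forms are at
  -- least a (σ i)‖x‖² and at most b (τ i)‖x‖².
  let f : (Fin n → ℝ) →ₗ[ℝ] ({j : Fin n // j ≠ i} → ℝ) := LinearMap.pi fun j =>
    if (j : Fin n) < i then (LinearMap.proj (σ j)).comp V.mulVecLin
    else (LinearMap.proj (τ j)).comp W.mulVecLin
  have hker : LinearMap.ker f ≠ ⊥ := by
    apply f.ker_ne_bot_of_finrank_lt
    have : 0 < n := i.pos
    simp
    omega
  obtain ⟨x, hx, hx0⟩ := (Submodule.ne_bot_iff _).1 hker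
  have hx1 : ∀ j < i, (V *ᵥ x) (σ j) = 0 := fun j hj => by
    have := congrFun (LinearMap.mem_ker.1 hx) ⟨j, hj.ne⟩
    simpa [f, hj] using this
  have hx2 : ∀ j, i < j → (W *ᵥ x) (τ j) = 0 := fun j hj => by
    have := congrFun (LinearMap.mem_ker.1 hx) ⟨j, hj.ne'⟩
    simpa [f, not_lt.2 hj.le] using this
  have hpos : 0 < ∑ j, x j ^ 2 := by
    obtain ⟨j, hj⟩ := Function.ne_iff.1 hx0
    exact Finset.sum_pos' (fun _ _ => sq_nonneg _) ⟨j, Finset.mem_univ _, by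
      simpa using sq_pos_of_ne_zero hj⟩
  have h1 : a (σ i) * ∑ j, x j ^ 2 ≤ ∑ j, a j * (V *ᵥ x) j ^ 2 := by
    rw [← sum_mulVec_sq hV x, Finset.mul_sum,
      ← Equiv.sum_comp σ (fun j => a (σ i) * (V *ᵥ x) j ^ 2),
      ← Equiv.sum_comp σ (fun j => a j * (V *ᵥ x) j ^ 2)]
    refine Finset.sum_le_sum fun j _ => ?_
    rcases lt_or_ge j i with hj | hj
    · simp [hx1 j hj]
    · exact mul_le_mul_of_nonneg_right (ha hj) (sq_nonneg _)
  have h2 : ∑ j, b j * (W *ᵥ x) j ^ 2 ≤ b (τ i) * ∑ j, x j ^ 2 := by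
    rw [← sum_mulVec_sq hW x, Finset.mul_sum,
      ← Equiv.sum_comp τ (fun j => b (τ i) * (W *ᵥ x) j ^ 2),
      ← Equiv.sum_comp τ (fun j => b j * (W *ᵥ x) j ^ 2)]
    refine Finset.sum_le_sum fun j _ => ?_
    rcases lt_or_ge i j with hj | hj
    · simp [hx2 j hj]
    · exact mul_le_mul_of_nonneg_right (hb hj) (sq_nonneg _)
  exact le_of_mul_le_mul_right (h1.trans ((hle x).trans h2)) hpos

/-- The square of `off`. -/
noncomputable def offSq {n : ℕ} (A : Matrix (Fin n) (Fin n) ℝ) : ℝ :=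
  ∑ i, ∑ j with j ≠ i, A i j ^ 2

lemma offSq_nonneg {n : ℕ} (A : Matrix (Fin n) (Fin n) ℝ) : 0 ≤ offSq A :=
  Finset.sum_nonneg fun _ _ => Finset.sum_nonneg fun _ _ => sq_nonneg _

lemma off_sq {n : ℕ} (A : Matrix (Fin n) (Fin n) ℝ) : off A ^ 2 = offSq A :=
  Real.sq_sqrt (offSq_nonneg A)

lemma scaled_apply {n : ℕ} (A : Matrix (Fin n) (Fin n) ℝ) (i j : Fin n) :
    scaled A i j = (√|A i i|)⁻¹ * A i j * (√|A j j|)⁻¹ := by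
  simp [scaled]

lemma eq_mul_scaled {n : ℕ} {A : Matrix (Fin n) (Fin n) ℝ} (hd : ∀ i, A i i ≠ 0) (i j : Fin n) :
    A i j = √|A i i| * scaled A i j * √|A j j| := by
  have h1 : √|A i i| ≠ 0 := (Real.sqrt_pos.2 (abs_pos.2 (hd i))).ne'
  have h2 : √|A j j| ≠ 0 := (Real.sqrt_pos.2 (abs_pos.2 (hd j))).ne'
  rw [scaled_apply]
  field_simp

lemma abs_sum_offdiag_le {n : ℕ} (E : Matrix (Fin n) (Fin n) ℝ) (y : Fin n → ℝ) :
    |∑ i, ∑ j with j ≠ i, E i j * (y i * y j)| ≤ off E * ∑ i, y i ^ 2 := by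
  have hnonneg : 0 ≤ off E * ∑ i, y i ^ 2 :=
    mul_nonneg (Real.sqrt_nonneg _) (Finset.sum_nonneg fun _ _ => sq_nonneg _)
  refine abs_le_of_sq_le_sq ?_ hnonneg
  rw [mul_pow, off_sq, offSq]
  simp only [Finset.sum_sigma']
  refine (Finset.sum_mul_sq_le_sq_mul_sq _ _ _).trans ?_
  refine mul_le_mul_of_nonneg_left ?_ (Finset.sum_nonneg fun _ _ => sq_nonneg _)
  rw [Finset.sum_sigma, sq (∑ i, y i ^ 2), Finset.sum_mul_sum]
  refine Finset.sum_le_sum fun i _ => ?_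
  simp only [mul_pow]
  exact Finset.sum_le_sum_of_subset_of_nonneg (Finset.filter_subset _ _)
    fun _ _ _ => by positivity

lemma quadForm_diagonal_conj {n : ℕ} (V : Matrix (Fin n) (Fin n) ℝ) (a : Fin n → ℝ)
    (x : Fin n → ℝ) :
    x ⬝ᵥ ((Vᵀ * Matrix.diagonal a * V) *ᵥ x) = ∑ j, a j * (V *ᵥ x) j ^ 2 := by
  rw [Matrix.mul_assoc, ← Matrix.mulVec_mulVec, Matrix.dotProduct_mulVec, Matrix.vecMul_transpose,
    ← Matrix.mulVec_mulVec]
  simp only [dotProduct, Matrix.mulVec_diagonal]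
  exact Finset.sum_congr rfl fun j _ => by ring

/-- The substitution y = |D|^(1/2) x turns the off-diagonal part into a form of the scaled matrix,
so its bound by `off` becomes an error relative to the diagonal. -/
lemma quadForm_eq {n : ℕ} {A : Matrix (Fin n) (Fin n) ℝ} (hd : ∀ i, A i i ≠ 0) (x : Fin n → ℝ) :
    x ⬝ᵥ (A *ᵥ x) = ∑ i, A i i * x i ^ 2 +
      ∑ i, ∑ j with j ≠ i, scaled A i j * ((√|A i i| * x i) * (√|A j j| * x j)) := by
  simp only [dotProduct, Matrix.mulVec, Finset.mul_sum]
  rw [← Finset.sum_add_distrib]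
  refine Finset.sum_congr rfl fun i _ => ?_
  rw [← Finset.add_sum_erase _ _ (Finset.mem_univ i)]
  congr 1
  · ring
  · refine Finset.sum_congr (by ext; simp) fun j _ => ?_
    conv_lhs => rw [eq_mul_scaled hd i j]
    ring

/-- The eigenvalues `lam` of a symmetric matrix are relative perturbations of its diagonal
entries, the relative distance being at most `off (scaled A)`. -/
lemma exists_perm_abs_sub_le {n : ℕ} {A V : Matrix (Fin n) (Fin n) ℝ} {lam : Fin n → ℝ}
    (hd : ∀ i, A i i ≠ 0) (hV : Vᵀ * V = 1) (hA : A = Vᵀ * Matrix.diagonal lam * V)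
    (hoff : off (scaled A) ≤ 1) :
    ∃ σ : Equiv.Perm (Fin n), ∀ i, |lam (σ i) - A i i| ≤ off (scaled A) * |A i i| := by
  set η := off (scaled A)
  have hη : 0 ≤ η := Real.sqrt_nonneg _
  let τ := Tuple.sort fun i => A i i
  let ν := Tuple.sort lam
  have hτ : Monotone ((fun i => A i i) ∘ τ) := Tuple.monotone_sort _
  have hν : Monotone (lam ∘ ν) := Tuple.monotone_sort _
  have hform (x : Fin n → ℝ) :
      |∑ j, lam j * (V *ᵥ x) j ^ 2 - ∑ i, A i i * x i ^ 2| ≤ ∑ i, η * |A i i| * x i ^ 2 := by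
    rw [← quadForm_diagonal_conj, ← hA, quadForm_eq hd, add_sub_cancel_left]
    refine (abs_sum_offdiag_le _ _).trans_eq ?_
    rw [Finset.mul_sum]
    refine Finset.sum_congr rfl fun i _ => ?_
    rw [mul_pow, Real.sq_sqrt (abs_nonneg _)]; ring
  have hone : (1 : Matrix (Fin n) (Fin n) ℝ)ᵀ * 1 = 1 := by simp
  have key (i : Fin n) : lam (ν i) ≤ A (τ i) (τ i) + η * |A (τ i) (τ i)| := by
    refine eigenvalue_le_of_form_le (b := fun i => A i i + η * |A i i|) (τ := τ) hV hone hν ?_ ?_ i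
    -- t ↦ t + η|t| is monotone because η ≤ 1, so the permutation sorting the diagonal also sorts
    -- the perturbed diagonal.
    · intro i j hij
      have h := hτ hij
      simp only [Function.comp] at h ⊢
      have h3 := abs_sub_abs_le_abs_sub (A (τ i) (τ i)) (A (τ j) (τ j))
      rw [abs_sub_comm, abs_of_nonneg (sub_nonneg.2 h)] at h3
      nlinarith
    · intro x
      have := (abs_le.1 (hform x)).2
      simp only [Matrix.one_mulVec, add_mul, Finset.sum_add_distrib]
      linarith
  have key' (i : Fin n) : A (τ i) (τ i) - η * |A (τ i) (τ i)| ≤ lam (ν i) := by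
    refine eigenvalue_le_of_form_le (a := fun i => A i i - η * |A i i|) (σ := τ) hone hV ?_ hν ?_ i
    · intro i j hij
      have h := hτ hij
      simp only [Function.comp] at h ⊢
      have h3 := abs_sub_abs_le_abs_sub (A (τ j) (τ j)) (A (τ i) (τ i))
      rw [abs_of_nonneg (sub_nonneg.2 h)] at h3
      nlinarith
    · intro x
      have := (abs_le.1 (hform x)).1
      simp only [Matrix.one_mulVec, sub_mul, Finset.sum_sub_distrib]
      linarith
  refine ⟨τ.symm.trans ν, fun i => ?_⟩
  have h1 := key (τ.symm i)
  have h2 := key' (τ.symm i)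
  simp only [Equiv.apply_symm_apply] at h1 h2
  rw [Equiv.trans_apply, abs_le]
  constructor <;> linarith

/-! ### Passing the relative gap from the spectrum to the diagonal. -/

lemma relGap_le {n : ℕ} {A : Matrix (Fin n) (Fin n) ℝ} (hA : A.IsHermitian) {i j : Fin n}
    (hij : i ≠ j) :
    relGap hA ≤ |hA.eigenvalues i - hA.eigenvalues j| /
      (|hA.eigenvalues i| + |hA.eigenvalues j|) :=
  (ciInf_le (Set.finite_range _).bddBelow j).trans
    (ciInf_le (Set.finite_range _).bddBelow (⟨i, hij⟩ : {i : Fin n // i ≠ j}))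

lemma relGap_mul_le {n : ℕ} {A : Matrix (Fin n) (Fin n) ℝ} (hA : A.IsHermitian) {i j : Fin n}
    (hij : i ≠ j) :
    relGap hA * (|hA.eigenvalues i| + |hA.eigenvalues j|) ≤
      |hA.eigenvalues i - hA.eigenvalues j| := by
  rcases (add_nonneg (abs_nonneg (hA.eigenvalues i)) (abs_nonneg (hA.eigenvalues j))).eq_or_lt'
    with h | h
  · rw [h, mul_zero]; exact abs_nonneg _
  · exact (le_div_iff₀ h).1 (relGap_le hA hij)

lemma exists_diagonalization {n : ℕ} {A : Matrix (Fin n) (Fin n) ℝ} (hA : A.IsHermitian) :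
    ∃ V : Matrix (Fin n) (Fin n) ℝ, Vᵀ * V = 1 ∧
      A = Vᵀ * Matrix.diagonal hA.eigenvalues * V := by
  have h := hA.spectral_theorem
  let U : Matrix (Fin n) (Fin n) ℝ := hA.eigenvectorUnitary
  have hU : U * Uᴴ = 1 := (Matrix.mem_unitaryGroup_iff).1 hA.eigenvectorUnitary.2
  refine ⟨Uᵀ, by simpa [Matrix.conjTranspose_eq_transpose_of_trivial] using hU, ?_⟩
  conv_lhs => rw [h]
  simp [Unitary.conjStarAlgAut_apply, U, Matrix.star_eq_conjTranspose,
    Matrix.conjTranspose_eq_transpose_of_trivial]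

/-- The relative gap of the spectrum is inherited by the diagonal entries. -/
lemma gap_diag {n : ℕ} {A₀ A V : Matrix (Fin n) (Fin n) ℝ} (hA₀ : A₀.IsHermitian)
    (hd : ∀ i, A i i ≠ 0) (hV : Vᵀ * V = 1) (hA : A = Vᵀ * Matrix.diagonal hA₀.eigenvalues * V)
    {η : ℝ} (hoff : off (scaled A) ≤ η) (hη : η ≤ 1) (hγ : 0 ≤ relGap hA₀) {i j : Fin n}
    (hij : i ≠ j) :
    (relGap hA₀ * (1 - η) - η) * (|A i i| + |A j j|) ≤ |A i i - A j j| := by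
  obtain ⟨σ, hσ⟩ := exists_perm_abs_sub_le hd hV hA (hoff.trans hη)
  have hb (i : Fin n) := (hσ i).trans (mul_le_mul_of_nonneg_right hoff (abs_nonneg _))
  have h1 := relGap_mul_le hA₀ (σ.injective.ne hij)
  set x := hA₀.eigenvalues (σ i)
  set y := hA₀.eigenvalues (σ j)
  have hx := hb i
  have hy := hb j
  -- Replacing eigenvalues by diagonal entries costs η(|a_ii| + |a_jj|) in the difference and a
  -- factor 1 − η in the sum.
  have h2 : |x - y| ≤ |A i i - A j j| + η * |A i i| + η * |A j j| := by
    have : x - y = (A i i - A j j) + (x - A i i) - (y - A j j) := by ring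
    rw [this]
    refine (abs_sub _ _).trans ?_
    have := abs_add_le (A i i - A j j) (x - A i i)
    linarith
  have h3 : (1 - η) * |A i i| ≤ |x| := by
    have := abs_sub_abs_le_abs_sub (A i i) x
    rw [abs_sub_comm] at this
    linarith
  have h4 : (1 - η) * |A j j| ≤ |y| := by
    have := abs_sub_abs_le_abs_sub (A j j) y
    rw [abs_sub_comm] at this
    linarith
  have h5 := mul_le_mul_of_nonneg_left (add_le_add h3 h4) hγ
  linarith

/-! ### The recurrence behind one cycle. -/

/-- A sweep that annihilates the entries `Y 0, …, Y (N - 1)` one after the other, where the entries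
annihilated before fill up again with contributions controlled by the couplings `H`. -/
lemma sweep_bound {N : ℕ} {Y Z : ℕ → ℕ → ℝ} {H : ℕ → ℕ → ℕ → ℝ} {θ v ρ E M : ℝ}
    (hθ : 0 ≤ θ) (hρ : 0 ≤ ρ)
    (hY : ∀ t j, 0 ≤ Y t j) (hH : ∀ t i j, 0 ≤ H t i j)
    (hYpiv : ∀ t < N, Y (t + 1) t = 0)
    (hYstep : ∀ t < N, ∀ j < N, j ≠ t → Y (t + 1) j ≤ Y t j + θ * Y t t * H t t j)
    (hHrest : ∀ t < N, ∀ i < N, ∀ j < N, i ≠ t → j ≠ t → H (t + 1) i j = H t i j)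
    (hHstep : ∀ t < N, ∀ j < N, j ≠ t → H (t + 1) j t ≤ ρ * (H t t j + v * Y t t * Z t j))
    (hE : ∑ t ∈ Finset.range N, ∑ j ∈ Finset.range N, (if t < j then H 0 t j else 0) ^ 2 ≤ E)
    (hM : ∀ t < N, ∑ j ∈ Finset.range N, Z t j ^ 2 ≤ M) (hv : 0 ≤ v) (hZ : ∀ t j, 0 ≤ Z t j) :
    ∃ Q, 0 ≤ Q ∧ Q * (1 - 2 * θ ^ 2 * E) ≤ 2 * ∑ j ∈ Finset.range N, Y 0 j ^ 2 ∧
      ∑ j ∈ Finset.range N, Y N j ^ 2 ≤ 2 * θ ^ 2 * ρ ^ 2 * Q * (E + v ^ 2 * Q * M) := by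
  -- Couplings between indices not yet treated keep their initial values.
  have hA : ∀ t ≤ N, ∀ i < N, ∀ j < N, t ≤ i → t ≤ j → H t i j = H 0 i j := by
    intro t
    induction t with
    | zero => intros; rfl
    | succ t ih =>
      intro ht i hi j hj hti htj
      rw [hHrest t (by omega) i hi j hj (by omega) (by omega),
        ih (by omega) i hi j hj (by omega) (by omega)]
  have hB : ∀ t ≤ N, ∀ j < N, t ≤ j →
      Y t j ≤ Y 0 j + θ * ∑ s ∈ Finset.range t, Y s s * H 0 s j := by
    intro t
    induction t with
    | zero => intros; simp
    | succ t ih =>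
      intro ht j hj htj
      have h1 := hYstep t (by omega) j hj (by omega)
      rw [hA t (by omega) t (by omega) j hj le_rfl (by omega)] at h1
      have h2 := ih (by omega) j hj (by omega)
      rw [Finset.sum_range_succ]
      linarith
  -- A coupling between a treated index j and an untreated i has changed only once, at step j.
  have hC : ∀ t ≤ N, ∀ i < N, ∀ j < t, t ≤ i →
      H t i j ≤ ρ * (H 0 j i + v * Y j j * Z j i) := by
    intro t
    induction t with
    | zero => intro _ i _ j hj; omega
    | succ t ih =>
      intro ht i hi j hj hti
      rcases (Nat.lt_succ_iff.1 hj).eq_or_lt with rfl | hlt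
      · have := hHstep j (by omega) i hi (by omega)
        rwa [hA j (by omega) j (by omega) i hi le_rfl (by omega)] at this
      · rw [hHrest t (by omega) i hi j (by omega) (by omega) (by omega)]
        exact ih (by omega) i hi j hlt (by omega)
  -- After its annihilation at step j, the entry j consists only of later contributions.
  have hD : ∀ t ≤ N, ∀ j < t, Y t j ≤ θ * ∑ s ∈ Finset.Ico (j + 1) t, Y s s * H s s j := by
    intro t
    induction t with
    | zero => intro _ j hj; omega
    | succ t ih =>
      intro ht j hj
      rcases (Nat.lt_succ_iff.1 hj).eq_or_lt with rfl | hlt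
      · simp [hYpiv j (by omega)]
      · rw [Finset.sum_Ico_succ_top (by omega)]
        have h1 := hYstep t (by omega) j (by omega) (by omega)
        have h2 := ih (by omega) j hlt
        linarith
  -- `K` keeps the initial couplings above the diagonal, in order of treatment. Its column j governs
  -- what j receives before annihilation, its row j what refills it afterwards.
  set K : ℕ → ℕ → ℝ := fun t j => if t < j then H 0 t j else 0 with hK
  have hK0 : ∀ t j, 0 ≤ K t j := fun t j => by
    simp only [hK]; split_ifs; exacts [hH _ _ _, le_rfl]
  have hB' : ∀ j < N, Y j j ≤ Y 0 j + θ * ∑ s ∈ Finset.range N, Y s s * K s j := by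
    intro j hj
    refine (hB j hj.le j hj le_rfl).trans (add_le_add_right (mul_le_mul_of_nonneg_left ?_ hθ) _)
    calc ∑ s ∈ Finset.range j, Y s s * H 0 s j = ∑ s ∈ Finset.range j, Y s s * K s j :=
          Finset.sum_congr rfl fun s hs => by simp [hK, Finset.mem_range.1 hs]
      _ ≤ _ := Finset.sum_le_sum_of_subset_of_nonneg
          (Finset.range_subset_range.2 hj.le) fun _ _ _ => mul_nonneg (hY _ _) (hK0 _ _)
  have hD' : ∀ j < N, Y N j ≤ θ * ρ * (∑ s ∈ Finset.range N, Y s s * K j s +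
      v * Y j j * ∑ s ∈ Finset.range N, Y s s * Z j s) := by
    intro j hj
    refine (hD N le_rfl j hj).trans ?_
    rw [mul_assoc]
    refine mul_le_mul_of_nonneg_left ?_ hθ
    rw [Finset.mul_sum, ← Finset.sum_add_distrib, Finset.mul_sum]
    calc ∑ s ∈ Finset.Ico (j + 1) N, Y s s * H s s j
        ≤ ∑ s ∈ Finset.Ico (j + 1) N, ρ * (Y s s * K j s + v * Y j j * (Y s s * Z j s)) := by
          refine Finset.sum_le_sum fun s hs => ?_
          have hs' := Finset.mem_Ico.1 hs
          have h1 := hC s hs'.2.le s hs'.2 j (by omega) le_rfl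
          have h2 : K j s = H 0 j s := if_pos (by omega)
          rw [h2]
          have := mul_le_mul_of_nonneg_left h1 (hY s s)
          linarith
      _ ≤ _ := by
          refine Finset.sum_le_sum_of_subset_of_nonneg (fun s hs => ?_) fun s _ _ => ?_
          · simp only [Finset.mem_Ico, Finset.mem_range] at hs ⊢; omega
          · have h1 := hY s s
            have h2 := hK0 j s
            have h3 := hY j j
            have h4 := hZ j s
            positivity
  have hQ0 : 0 ≤ ∑ s ∈ Finset.range N, Y s s ^ 2 := Finset.sum_nonneg fun _ _ => sq_nonneg _
  refine ⟨∑ s ∈ Finset.range N, Y s s ^ 2, hQ0, ?_, ?_⟩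
  · set Q := ∑ s ∈ Finset.range N, Y s s ^ 2
    have h1 : ∀ j ∈ Finset.range N, Y j j ^ 2 ≤
        2 * Y 0 j ^ 2 + 2 * θ ^ 2 * Q * ∑ s ∈ Finset.range N, K s j ^ 2 := by
      intro j hj
      have h2 := hB' j (Finset.mem_range.1 hj)
      have h3 := Finset.sum_mul_sq_le_sq_mul_sq (Finset.range N) (fun s => Y s s) (fun s => K s j)
      have h4 := pow_le_pow_left₀ (hY j j) h2 2
      set x := ∑ s ∈ Finset.range N, Y s s * K s j
      have h5 : (Y 0 j + θ * x) ^ 2 ≤ 2 * Y 0 j ^ 2 + 2 * θ ^ 2 * x ^ 2 := by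
        linarith [sq_nonneg (Y 0 j - θ * x)]
      have h6 := mul_le_mul_of_nonneg_left h3 (by positivity : (0 : ℝ) ≤ 2 * θ ^ 2)
      linarith
    have h2 := Finset.sum_le_sum h1
    rw [Finset.sum_add_distrib, ← Finset.mul_sum, ← Finset.mul_sum, Finset.sum_comm] at h2
    have h3 := mul_le_mul_of_nonneg_left hE (by positivity : (0 : ℝ) ≤ 2 * θ ^ 2 * Q)
    linarith
  · set Q := ∑ s ∈ Finset.range N, Y s s ^ 2
    have h1 : ∀ j ∈ Finset.range N, Y N j ^ 2 ≤ 2 * θ ^ 2 * ρ ^ 2 * Q *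
        (∑ s ∈ Finset.range N, K j s ^ 2 + v ^ 2 * M * Y j j ^ 2) := by
      intro j hj
      have hj' := Finset.mem_range.1 hj
      have h2 := pow_le_pow_left₀ (hY N j) (hD' j hj') 2
      have h3 := Finset.sum_mul_sq_le_sq_mul_sq (Finset.range N) (fun s => Y s s) (fun s => K j s)
      have h4 := Finset.sum_mul_sq_le_sq_mul_sq (Finset.range N) (fun s => Y s s) (fun s => Z j s)
      have h5 := h4.trans (mul_le_mul_of_nonneg_left (hM j hj') hQ0)
      set x := ∑ s ∈ Finset.range N, Y s s * K j s
      set z := ∑ s ∈ Finset.range N, Y s s * Z j s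
      have h6 : (x + v * Y j j * z) ^ 2 ≤
          2 * (Q * ∑ s ∈ Finset.range N, K j s ^ 2) + 2 * (v * Y j j) ^ 2 * (Q * M) := by
        have := mul_le_mul_of_nonneg_left h5 (by positivity : (0 : ℝ) ≤ 2 * (v * Y j j) ^ 2)
        linarith [sq_nonneg (x - v * Y j j * z)]
      have h7 := mul_le_mul_of_nonneg_left h6 (sq_nonneg (θ * ρ))
      linarith
    have h2 := Finset.sum_le_sum h1
    rw [← Finset.mul_sum, Finset.sum_add_distrib, ← Finset.mul_sum] at h2
    refine h2.trans (mul_le_mul_of_nonneg_left ?_ (by positivity))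
    have : v ^ 2 * M * Q = v ^ 2 * Q * M := by ring
    linarith

/-! ### Splitting the off-diagonal norm along a plane. -/

lemma sum_eq_add_add_sum {n : ℕ} {m k : Fin n} (hmk : m ≠ k) (f : Fin n → ℝ) :
    ∑ j, f j = f m + f k + ∑ j with j ≠ m ∧ j ≠ k, f j := by
  have h : (Finset.univ : Finset (Fin n)) =
      insert m (insert k (Finset.univ.filter fun j => j ≠ m ∧ j ≠ k)) := by
    ext j; simp; tauto
  conv_lhs => rw [h]
  rw [Finset.sum_insert (by simp [hmk]), Finset.sum_insert (by simp), add_assoc]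

lemma offSq_eq {n : ℕ} {m k : Fin n} (hmk : m ≠ k) {M : Matrix (Fin n) (Fin n) ℝ}
    (hM : ∀ i j, M i j = M j i) :
    offSq M = 2 * M m k ^ 2 + 2 * ∑ j with j ≠ m ∧ j ≠ k, (M m j ^ 2 + M k j ^ 2) +
      ∑ i with i ≠ m ∧ i ≠ k, ∑ j with j ≠ m ∧ j ≠ k, if j ≠ i then M i j ^ 2 else 0 := by
  simp only [offSq, Finset.sum_filter (fun j => j ≠ _)]
  have hrow (i : Fin n) (hi : i ≠ m ∧ i ≠ k) : (∑ j, if j ≠ i then M i j ^ 2 else 0) =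
      M m i ^ 2 + M k i ^ 2 + ∑ j with j ≠ m ∧ j ≠ k, if j ≠ i then M i j ^ 2 else 0 := by
    rw [sum_eq_add_add_sum hmk, if_pos hi.1.symm, if_pos hi.2.symm, hM i m, hM i k]
  have hm : (∑ j with j ≠ m ∧ j ≠ k, if j ≠ m then M m j ^ 2 else 0) =
      ∑ j with j ≠ m ∧ j ≠ k, M m j ^ 2 :=
    Finset.sum_congr rfl fun j hj => if_pos (Finset.mem_filter.1 hj).2.1
  have hk : (∑ j with j ≠ m ∧ j ≠ k, if j ≠ k then M k j ^ 2 else 0) =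
      ∑ j with j ≠ m ∧ j ≠ k, M k j ^ 2 :=
    Finset.sum_congr rfl fun j hj => if_pos (Finset.mem_filter.1 hj).2.2
  rw [sum_eq_add_add_sum hmk, Finset.sum_congr rfl fun i hi => hrow i (Finset.mem_filter.1 hi).2,
    sum_eq_add_add_sum hmk, sum_eq_add_add_sum hmk, hm, hk, if_pos hmk, if_pos hmk.symm,
    if_neg (by simp), if_neg (by simp), hM k m]
  simp only [Finset.sum_add_distrib]
  ring

/-- By symmetry the row m is counted a second time as column m. -/
lemma sum_row_sq_le {n : ℕ} {m k : Fin n} (hmk : m ≠ k) {M : Matrix (Fin n) (Fin n) ℝ}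
    (hM : ∀ i j, M i j = M j i) : ∑ j with j ≠ m, M m j ^ 2 ≤ offSq M / 2 := by
  have h1 : ∑ j with j ≠ m, M m j ^ 2 = M m k ^ 2 + ∑ j with j ≠ m ∧ j ≠ k, M m j ^ 2 := by
    rw [Finset.sum_filter, sum_eq_add_add_sum hmk, if_neg (by simp), if_pos hmk.symm, zero_add]
    congr 1
    exact Finset.sum_congr rfl fun j hj => if_pos (Finset.mem_filter.1 hj).2.1
  have h2 := offSq_eq hmk hM
  rw [Finset.sum_add_distrib] at h2
  have h3 : 0 ≤ ∑ j with j ≠ m ∧ j ≠ k, M k j ^ 2 := Finset.sum_nonneg fun _ _ => sq_nonneg _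
  have h4 : 0 ≤ ∑ i with i ≠ m ∧ i ≠ k, ∑ j with j ≠ m ∧ j ≠ k,
      if j ≠ i then M i j ^ 2 else 0 :=
    Finset.sum_nonneg fun _ _ => Finset.sum_nonneg fun _ _ => by split_ifs <;> positivity
  linarith

lemma sq_le_offSq {n : ℕ} {m k : Fin n} (hmk : m ≠ k) {M : Matrix (Fin n) (Fin n) ℝ}
    (hM : ∀ i j, M i j = M j i) : M m k ^ 2 ≤ offSq M / 2 :=
  (Finset.single_le_sum (f := fun j => M m j ^ 2) (fun _ _ => sq_nonneg _)
    (Finset.mem_filter.2 ⟨Finset.mem_univ k, hmk.symm⟩)).trans (sum_row_sq_le hmk hM)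

/-! ### The effect of one rotation on a separated matrix. -/

/-- Symmetric matrices with relatively separated nonzero diagonal entries and a scaled off-diagonal
part that is small compared with the separation. -/
structure IsSeparated {n : ℕ} (A : Matrix (Fin n) (Fin n) ℝ) (g β : ℝ) : Prop where
  symm : ∀ i j, A i j = A j i
  diag_ne : ∀ i, A i i ≠ 0
  gap_pos : 0 < g
  gap : ∀ i j, i ≠ j → g * (|A i i| + |A j j|) ≤ |A i i - A j j|
  nonneg : 0 ≤ β
  offSq_le : offSq (scaled A) ≤ β ^ 2
  le_gap : 9 * β ≤ g
  le_one : 32 * β ≤ 1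

lemma scaled_symm {n : ℕ} {A : Matrix (Fin n) (Fin n) ℝ} (h : ∀ i j, A i j = A j i) (i j : Fin n) :
    scaled A i j = scaled A j i := by
  rw [scaled_apply, scaled_apply, h i j]; ring

section Rotated

variable {n : ℕ} {m k : Fin n} {A A' : Matrix (Fin n) (Fin n) ℝ} {c s c' s' e g β : ℝ}

lemma IsSeparated.sqrt_pos (hA : IsSeparated A g β) (i : Fin n) : 0 < √|A i i| :=
  Real.sqrt_pos.2 (abs_pos.2 (hA.diag_ne i))

/-- The quotient h²/g bounds the relative shift of the two diagonal entries. Here h² ≤ β²/2 and 9β ≤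
g. -/
lemma IsSeparated.eps_le (hA : IsSeparated A g β) (hmk : m ≠ k) :
    scaled A m k ^ 2 / g ≤ β / 18 := by
  have h1 := (sq_le_offSq hmk (scaled_symm hA.symm)).trans
    (div_le_div_of_nonneg_right hA.offSq_le two_pos.le)
  rw [div_le_iff₀ hA.gap_pos]
  have := mul_le_mul_of_nonneg_left hA.le_gap hA.nonneg
  linarith

lemma IsSeparated.abs_eq (hA : IsSeparated A g β) (i j : Fin n) :
    |A i j| = √|A i i| * |scaled A i j| * √|A j j| := by
  conv_lhs => rw [eq_mul_scaled hA.diag_ne i j]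
  rw [abs_mul, abs_mul, abs_of_pos (hA.sqrt_pos i), abs_of_pos (hA.sqrt_pos j)]

lemma IsRotated.sin_mul_le (hR : IsRotated m k A A' c s c' s' e) (hA : IsSeparated A g β)
    (hmk : m ≠ k) : |s| * (g * (|A m m| + |A k k|)) ≤ |A m k| :=
  (mul_le_mul_of_nonneg_left (hA.gap m k hmk) (abs_nonneg _)).trans hR.sin_le

/-- From e·g(|a_mm| + |a_kk|) ≤ a_mk² = h²|a_mm||a_kk|; a product divided by the sum of its factors
is at most either factor. -/
lemma IsRotated.shift_le_mul (hR : IsRotated m k A A' c s c' s' e) (hA : IsSeparated A g β)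
    (hmk : m ≠ k) :
    e ≤ scaled A m k ^ 2 / g * |A m m| ∧ e ≤ scaled A m k ^ 2 / g * |A k k| := by
  have hm := abs_pos.2 (hA.diag_ne m)
  have hk := abs_pos.2 (hA.diag_ne k)
  have hg := hA.gap_pos
  have h1 := (mul_le_mul_of_nonneg_left (hA.gap m k hmk) hR.shift_nonneg).trans hR.shift_le
  have h2 : A m k ^ 2 = scaled A m k ^ 2 * |A m m| * |A k k| := by
    rw [eq_mul_scaled hA.diag_ne m k, mul_pow, mul_pow, Real.sq_sqrt hm.le, Real.sq_sqrt hk.le]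
    ring
  rw [h2] at h1
  have hs : 0 < |A m m| + |A k k| := by positivity
  have hq : 0 ≤ scaled A m k ^ 2 := sq_nonneg _
  constructor
  · rw [div_mul_eq_mul_div, le_div_iff₀ hg]
    refine le_of_mul_le_mul_right (a := |A m m| + |A k k|) ?_ hs
    have : 0 ≤ scaled A m k ^ 2 * |A m m| * |A m m| := by positivity
    linarith
  · rw [div_mul_eq_mul_div, le_div_iff₀ hg]
    refine le_of_mul_le_mul_right (a := |A m m| + |A k k|) ?_ hs
    have : 0 ≤ scaled A m k ^ 2 * |A k k| * |A k k| := by positivity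
    linarith

lemma IsRotated.abs_diag_sub (hR : IsRotated m k A A' c s c' s' e) (hmk : m ≠ k) :
    |A' m m - A m m| = e ∧ |A' k k - A k k| = e := by
  have he := abs_of_nonneg hR.shift_nonneg
  rcases lt_or_gt_of_ne hmk with h | h
  · obtain ⟨h1, h2⟩ := hR.diag_of_gt h
    rw [h1, h2, add_sub_cancel_left, sub_sub_cancel_left, abs_neg]
    exact ⟨he, he⟩
  · obtain ⟨h1, h2⟩ := hR.diag_of_lt h
    rw [h1, h2, add_sub_cancel_left, sub_sub_cancel_left, abs_neg]
    exact ⟨he, he⟩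

lemma IsRotated.le_abs_diag (hR : IsRotated m k A A' c s c' s' e) (hA : IsSeparated A g β)
    (hmk : m ≠ k) :
    (1 - scaled A m k ^ 2 / g) * |A m m| ≤ |A' m m| ∧
      (1 - scaled A m k ^ 2 / g) * |A k k| ≤ |A' k k| := by
  obtain ⟨h1, h2⟩ := hR.shift_le_mul hA hmk
  obtain ⟨h3, h4⟩ := hR.abs_diag_sub hmk
  have h5 := abs_sub_abs_le_abs_sub (A m m) (A' m m)
  have h6 := abs_sub_abs_le_abs_sub (A k k) (A' k k)
  rw [abs_sub_comm, h3] at h5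
  rw [abs_sub_comm, h4] at h6
  constructor <;> linarith

lemma IsRotated.diag_ne_zero (hR : IsRotated m k A A' c s c' s' e) (hA : IsSeparated A g β)
    (hmk : m ≠ k) (i : Fin n) : A' i i ≠ 0 := by
  have h1 := hA.eps_le hmk
  have h2 := hA.le_one
  obtain ⟨h3, h4⟩ := hR.le_abs_diag hA hmk
  have hpos (i : Fin n) : 0 < (1 - scaled A m k ^ 2 / g) * |A i i| :=
    mul_pos (by linarith) (abs_pos.2 (hA.diag_ne i))
  by_cases him : i = m
  · subst him; exact abs_pos.1 ((hpos i).trans_le h3)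
  by_cases hik : i = k
  · subst hik; exact abs_pos.1 ((hpos i).trans_le h4)
  rw [hR.rest i i him hik him hik]
  exact hA.diag_ne i

lemma IsRotated.scaled_rest (hR : IsRotated m k A A' c s c' s' e) {i j : Fin n} (him : i ≠ m)
    (hik : i ≠ k) (hjm : j ≠ m) (hjk : j ≠ k) : scaled A' i j = scaled A i j := by
  rw [scaled_apply, scaled_apply, hR.rest i j him hik hjm hjk, hR.rest i i him hik him hik,
    hR.rest j j hjm hjk hjm hjk]

/-- A rotation in scaled coordinates: the mixed terms are controlled by the scaled pivot `h`
alone, without reference to the gap. -/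
lemma scaled_rotation_le {r t x y h ε : ℝ} (hcs : c ^ 2 + s ^ 2 = 1)
    (hc : c' ^ 2 = c ^ 2) (hs : s' ^ 2 = s ^ 2) (hortho : c * s + c' * s' = 0)
    (h1 : |s| * |t ^ 2 - r ^ 2| ≤ h * (r * t))
    (hrt : 0 < r * t) (h2 : s ^ 2 * |t ^ 2 - r ^ 2| ≤ ε * r ^ 2)
    (h3 : s ^ 2 * |t ^ 2 - r ^ 2| ≤ ε * t ^ 2) :
    t ^ 2 * (c * r * x + s * t * y) ^ 2 + r ^ 2 * (c' * t * y + s' * r * x) ^ 2 ≤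
      (1 + ε + h) * (x ^ 2 + y ^ 2) * (r * t) ^ 2 := by
  have hc1 : |c| ≤ 1 := by
    rw [← sq_le_one_iff_abs_le_one]; linarith [sq_nonneg s]
  -- With c² = 1 − s² the main part is (x² + y²)(rt)²; each remaining term contains t² − r².
  have e1 : t ^ 2 * (c * r * x + s * t * y) ^ 2 + r ^ 2 * (c' * t * y + s' * r * x) ^ 2 =
      c ^ 2 * (x ^ 2 + y ^ 2) * (r * t) ^ 2 + s ^ 2 * t ^ 2 * t ^ 2 * y ^ 2 +
        s ^ 2 * r ^ 2 * r ^ 2 * x ^ 2 + 2 * (r * t) * (x * y) * (c * s * (t ^ 2 - r ^ 2)) := by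
    linear_combination r ^ 2 * t ^ 2 * y ^ 2 * hc + r ^ 4 * x ^ 2 * hs +
      2 * r ^ 3 * t * x * y * hortho
  have h4 : |c * s * (t ^ 2 - r ^ 2)| ≤ h * (r * t) := by
    rw [abs_mul, abs_mul, mul_assoc]
    exact (mul_le_of_le_one_left (by positivity) hc1).trans h1
  have h5 : |x * y| ≤ (x ^ 2 + y ^ 2) / 2 := by
    rw [abs_mul]
    linarith [sq_nonneg (|x| - |y|), sq_abs x, sq_abs y]
  have h6 : x * y * (c * s * (t ^ 2 - r ^ 2)) ≤ (x ^ 2 + y ^ 2) / 2 * (h * (r * t)) := by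
    refine (le_abs_self _).trans ?_
    rw [abs_mul (x * y)]
    exact mul_le_mul h5 h4 (abs_nonneg _) (by positivity)
  have h7 := mul_le_mul_of_nonneg_left h6 (by positivity : (0 : ℝ) ≤ 2 * (r * t))
  have h8 : s ^ 2 * t ^ 2 ≤ s ^ 2 * r ^ 2 + ε * r ^ 2 := by
    have := mul_le_mul_of_nonneg_left (le_abs_self (t ^ 2 - r ^ 2)) (sq_nonneg s)
    linarith
  have h9 : s ^ 2 * r ^ 2 ≤ s ^ 2 * t ^ 2 + ε * t ^ 2 := by
    have := mul_le_mul_of_nonneg_left (neg_le_abs (t ^ 2 - r ^ 2)) (sq_nonneg s)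
    linarith
  have h10 := mul_le_mul_of_nonneg_right h8 (by positivity : (0 : ℝ) ≤ t ^ 2 * y ^ 2)
  have h11 := mul_le_mul_of_nonneg_right h9 (by positivity : (0 : ℝ) ≤ r ^ 2 * x ^ 2)
  have hc2 : c ^ 2 = 1 - s ^ 2 := by linarith
  rw [e1, hc2]
  linarith

lemma IsRotated.scaled_sq_add_sq_le (hR : IsRotated m k A A' c s c' s' e)
    (hA : IsSeparated A g β) (hmk : m ≠ k) {j : Fin n} (hjm : j ≠ m) (hjk : j ≠ k) :
    (1 - scaled A m k ^ 2 / g) * (scaled A' m j ^ 2 + scaled A' k j ^ 2) ≤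
      (1 + scaled A m k ^ 2 / g + |scaled A m k|) *
        (scaled A m j ^ 2 + scaled A k j ^ 2) := by
  have hr := hA.sqrt_pos m
  have ht := hA.sqrt_pos k
  have hu := hA.sqrt_pos j
  have hg := hA.gap_pos
  obtain ⟨hdm, hdk⟩ := hR.le_abs_diag hA hmk
  have hd'm := abs_pos.2 (hR.diag_ne_zero hA hmk m)
  have hd'k := abs_pos.2 (hR.diag_ne_zero hA hmk k)
  have hε1 : 0 < 1 - scaled A m k ^ 2 / g := by
    linarith [hA.eps_le hmk, hA.le_one]
  have hsin := hR.sin_mul_le hA hmk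
  have hsin' := hR.sin_le
  have habs := abs_abs_sub_abs_le_abs_sub (A k k) (A m m)
  rw [abs_sub_comm (A k k)] at habs
  have hpiv := hA.abs_eq m k
  have hmj := eq_mul_scaled hA.diag_ne m j
  have hkj := eq_mul_scaled hA.diag_ne k j
  have hr2 : √|A m m| ^ 2 = |A m m| := Real.sq_sqrt (abs_nonneg _)
  have ht2 : √|A k k| ^ 2 = |A k k| := Real.sq_sqrt (abs_nonneg _)
  have e1 : scaled A' m j ^ 2 = (c * A m j + s * A k j) ^ 2 / (|A' m m| * √|A j j| ^ 2) := by
    rw [scaled_apply, hR.rest j j hjm hjk hjm hjk, hR.row_m j hjm hjk, mul_pow, mul_pow, inv_pow,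
      inv_pow, Real.sq_sqrt hd'm.le]
    field_simp
  have e2 : scaled A' k j ^ 2 = (c' * A k j + s' * A m j) ^ 2 / (|A' k k| * √|A j j| ^ 2) := by
    rw [scaled_apply, hR.rest j j hjm hjk hjm hjk, hR.row_k j hjm hjk, mul_pow, mul_pow, inv_pow,
      inv_pow, Real.sq_sqrt hd'k.le]
    field_simp
  rw [e1, e2, hmj, hkj]
  rw [← hr2, ← ht2] at hsin habs
  rw [← hr2] at hdm
  rw [← ht2] at hdk
  rw [hpiv] at hsin hsin'
  generalize scaled A m k = h at *
  generalize scaled A m j = x at *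
  generalize scaled A k j = y at *
  generalize √|A m m| = r at *
  generalize √|A k k| = t at *
  generalize √|A j j| = u at *
  have h1 : |s| * |t ^ 2 - r ^ 2| ≤ |h| * (r * t) := by
    have := mul_le_mul_of_nonneg_left habs (abs_nonneg s)
    linarith
  have h2 : |s| * (r ^ 2 + t ^ 2) ≤ |h| / g * (r * t) := by
    rw [div_mul_eq_mul_div, le_div_iff₀ hg]; linarith
  have hh : |h| / g * |h| = h ^ 2 / g := by
    rw [div_mul_eq_mul_div, abs_mul_abs_self, sq]
  -- One factor of the sine is estimated without the gap and the other with it, so that only a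
  -- single 1/g appears.
  have h3 : s ^ 2 * |t ^ 2 - r ^ 2| * (r ^ 2 + t ^ 2) ≤ h ^ 2 / g * (r * t) ^ 2 := by
    have := mul_le_mul h1 h2 (by positivity) (by positivity)
    rw [← sq_abs s, ← hh]
    linarith
  have hε : 0 ≤ h ^ 2 / g := by positivity
  have hrt : 0 < r ^ 2 + t ^ 2 := by positivity
  have h4 : s ^ 2 * |t ^ 2 - r ^ 2| ≤ h ^ 2 / g * r ^ 2 := by
    refine le_of_mul_le_mul_right (h3.trans ?_) hrt
    have : 0 ≤ h ^ 2 / g * (r ^ 2 * r ^ 2) := by positivity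
    linarith
  have h5 : s ^ 2 * |t ^ 2 - r ^ 2| ≤ h ^ 2 / g * t ^ 2 := by
    refine le_of_mul_le_mul_right (h3.trans ?_) hrt
    have : 0 ≤ h ^ 2 / g * (t ^ 2 * t ^ 2) := by positivity
    linarith
  have h6 := scaled_rotation_le (x := x) (y := y) hR.sq_add_sq hR.cos_sq hR.sin_sq hR.ortho
    h1 (mul_pos hr ht) h4 h5
  have f1 : (1 - h ^ 2 / g) * ((c * (r * x * u) + s * (t * y * u)) ^ 2 / (|A' m m| * u ^ 2)) ≤
      (c * r * x + s * t * y) ^ 2 / r ^ 2 := by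
    have : (1 - h ^ 2 / g) * ((c * (r * x * u) + s * (t * y * u)) ^ 2 / (|A' m m| * u ^ 2)) =
        (1 - h ^ 2 / g) * (c * r * x + s * t * y) ^ 2 / |A' m m| := by
      field_simp
    rw [this, div_le_div_iff₀ hd'm (by positivity)]
    have := mul_le_mul_of_nonneg_right hdm (sq_nonneg (c * r * x + s * t * y))
    linarith
  have f2 : (1 - h ^ 2 / g) * ((c' * (t * y * u) + s' * (r * x * u)) ^ 2 / (|A' k k| * u ^ 2)) ≤
      (c' * t * y + s' * r * x) ^ 2 / t ^ 2 := by
    have : (1 - h ^ 2 / g) * ((c' * (t * y * u) + s' * (r * x * u)) ^ 2 / (|A' k k| * u ^ 2)) =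
        (1 - h ^ 2 / g) * (c' * t * y + s' * r * x) ^ 2 / |A' k k| := by
      field_simp
    rw [this, div_le_div_iff₀ hd'k (by positivity)]
    have := mul_le_mul_of_nonneg_right hdk (sq_nonneg (c' * t * y + s' * r * x))
    linarith
  rw [mul_add]
  refine (add_le_add f1 f2).trans ?_
  rw [div_add_div _ _ (by positivity) (by positivity), div_le_iff₀ (by positivity)]
  linarith

/-- One rotation increases the square of the scaled off-diagonal norm by a quantity of the
fourth order only. -/
lemma IsRotated.offSq_scaled_le (hR : IsRotated m k A A' c s c' s' e)
    (hA : IsSeparated A g β) (hmk : m ≠ k) :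
    offSq (scaled A') ≤ offSq (scaled A) + offSq (scaled A) ^ 2 / 5 := by
  have h1 := offSq_eq hmk (scaled_symm hA.symm)
  have h2 := offSq_eq hmk (scaled_symm hR.symm)
  have hz : scaled A' m k = 0 := by rw [scaled_apply, hR.pivot_eq_zero]; ring
  have hrest : (∑ i with i ≠ m ∧ i ≠ k, ∑ j with j ≠ m ∧ j ≠ k,
      if j ≠ i then scaled A' i j ^ 2 else 0) =
      ∑ i with i ≠ m ∧ i ≠ k, ∑ j with j ≠ m ∧ j ≠ k,
        if j ≠ i then scaled A i j ^ 2 else 0 := by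
    refine Finset.sum_congr rfl fun i hi => Finset.sum_congr rfl fun j hj => ?_
    simp only [Finset.mem_filter] at hi hj
    rw [hR.scaled_rest hi.2.1 hi.2.2 hj.2.1 hj.2.2]
  have h4 : 0 ≤ ∑ i with i ≠ m ∧ i ≠ k, ∑ j with j ≠ m ∧ j ≠ k,
      if j ≠ i then scaled A i j ^ 2 else 0 :=
    Finset.sum_nonneg fun _ _ => Finset.sum_nonneg fun _ _ => by split_ifs <;> positivity
  rw [hrest, hz] at h2
  have h3 : (1 - scaled A m k ^ 2 / g) *
        ∑ j with j ≠ m ∧ j ≠ k, (scaled A' m j ^ 2 + scaled A' k j ^ 2) ≤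
      (1 + scaled A m k ^ 2 / g + |scaled A m k|) *
        ∑ j with j ≠ m ∧ j ≠ k, (scaled A m j ^ 2 + scaled A k j ^ 2) := by
    rw [Finset.mul_sum, Finset.mul_sum]
    refine Finset.sum_le_sum fun j hj => ?_
    simp only [Finset.mem_filter] at hj
    exact hR.scaled_sq_add_sq_le hA hmk hj.2.1 hj.2.2
  have hε := hA.eps_le hmk
  have hβ := hA.le_one
  have hg := hA.gap_pos
  have hS := hA.offSq_le
  have hSg : offSq (scaled A) ≤ g / 288 := by
    have := mul_le_mul hA.le_gap hA.le_one (by linarith [hA.nonneg]) hg.le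
    linarith
  have hSε : offSq (scaled A) * (scaled A m k ^ 2 / g) ≤ scaled A m k ^ 2 / 288 := by
    rw [mul_div_assoc', div_le_div_iff₀ hg (by norm_num)]
    have := mul_le_mul_of_nonneg_left hSg (sq_nonneg (scaled A m k))
    linarith
  have hN0 : 0 ≤ ∑ j with j ≠ m ∧ j ≠ k, (scaled A m j ^ 2 + scaled A k j ^ 2) :=
    Finset.sum_nonneg fun _ _ => by positivity
  have hε0 : 0 ≤ scaled A m k ^ 2 / g := by positivity
  have hh0 := abs_nonneg (scaled A m k)
  have hh2 := (sq_abs (scaled A m k)).symm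
  have hS0 := offSq_nonneg (scaled A)
  rw [hh2] at h1 h3 hε hSε hε0
  generalize |scaled A m k| = h at *
  generalize h ^ 2 / g = ε at *
  generalize (∑ j with j ≠ m ∧ j ≠ k, (scaled A m j ^ 2 + scaled A k j ^ 2)) = N at *
  generalize (∑ j with j ≠ m ∧ j ≠ k, (scaled A' m j ^ 2 + scaled A' k j ^ 2)) = N' at *
  generalize offSq (scaled A) = S at *
  generalize offSq (scaled A') = S' at *
  generalize (∑ i with i ≠ m ∧ i ≠ k, ∑ j with j ≠ m ∧ j ≠ k,
    if j ≠ i then scaled A i j ^ 2 else 0) = R at *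
  have hε2 : ε ≤ 1 / 576 := by linarith
  have h5 : (2 * ε + h) * (2 * N) ≤ (2 * ε + h) * S :=
    mul_le_mul_of_nonneg_left (by linarith [sq_nonneg h]) (by linarith)
  have h6 : (1 - ε) * (S' - S) ≤ (2 * ε + h) * S - (1 - ε) * (2 * h ^ 2) := by
    have : S' - S = 2 * N' - 2 * N - 2 * h ^ 2 := by linarith
    rw [this]
    linarith
  -- The gain hS is paid for by the loss 2h² of the annihilated pivot, up to a multiple of S². The
  -- term εS is at most h²/288, hence also absorbed by that loss.
  have h7 : (2 * ε + h) * S - (1 - ε) * (2 * h ^ 2) ≤ (1 - ε) * (S ^ 2 / 5) := by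
    have h8 := mul_le_mul_of_nonneg_right hε2 (sq_nonneg h)
    have h9 := mul_le_mul_of_nonneg_right hε2 (sq_nonneg S)
    nlinarith [sq_nonneg (5 * h - 2 * S), sq_nonneg h, sq_nonneg S]
  have h8 := h6.trans h7
  have h9 := le_of_mul_le_mul_left h8 (by linarith)
  linarith

/-- Since the two entries move apart, a_mm can only approach entries on the side away from k, and
its shift is smaller than its distance to them. The other entries need not stay sorted among
themselves: a step compares only with entry m. -/
lemma IsRotated.lt_diag_of_lt (hR : IsRotated m k A A' c s c' s' e) (hA : IsSeparated A g β)
    (hmk : m ≠ k) (hlt : ∀ i < m, A i i < A m m) (hgt : ∀ i, m < i → A m m < A i i) :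
    (∀ i < m, A' i i < A' m m) ∧ ∀ i, m < i → A' m m < A' i i := by
  have he := hR.shift_nonneg
  have he' : e < g * |A m m| := by
    refine (hR.shift_le_mul hA hmk).1.trans_lt
      (mul_lt_mul_of_pos_right ?_ (abs_pos.2 (hA.diag_ne m)))
    linarith [hA.eps_le hmk, hA.le_gap, hA.nonneg, hA.gap_pos]
  have hfar (i : Fin n) (hi : i ≠ m) : e < |A i i - A m m| := by
    refine he'.trans_le (le_trans ?_ (hA.gap i m hi))
    exact mul_le_mul_of_nonneg_left (by linarith [abs_nonneg (A i i)]) hA.gap_pos.le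
  rcases lt_or_gt_of_ne hmk with h | h
  · obtain ⟨h1, h2⟩ := hR.diag_of_gt h
    constructor
    · intro i hi
      rw [h1, hR.rest i i hi.ne (hi.trans h).ne hi.ne (hi.trans h).ne]
      have := hfar i hi.ne
      rw [abs_of_neg (sub_neg.2 (hlt i hi))] at this
      linarith
    · intro i hi
      rw [h1]
      by_cases hik : i = k
      · subst hik; rw [h2]; linarith [hgt i hi]
      · rw [hR.rest i i hi.ne' hik hi.ne' hik]; linarith [hgt i hi]
  · obtain ⟨h1, h2⟩ := hR.diag_of_lt h
    constructor
    · intro i hi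
      rw [h1]
      by_cases hik : i = k
      · subst hik; rw [h2]; linarith [hlt i hi]
      · rw [hR.rest i i hi.ne hik hi.ne hik]; linarith [hlt i hi]
    · intro i hi
      rw [h1, hR.rest i i hi.ne' (h.trans hi).ne' hi.ne' (h.trans hi).ne']
      have := hfar i hi.ne'
      rw [abs_of_pos (sub_pos.2 (hgt i hi))] at this
      linarith

/-- Row m is weighted by its column index only. The weight of column j changes only when j is the
pivot, so no rescaling factor accumulates within a cycle. -/
lemma IsRotated.abs_row_m_le (hR : IsRotated m k A A' c s c' s' e) (hA : IsSeparated A g β)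
    (hmk : m ≠ k) {j : Fin n} (hjm : j ≠ m) (hjk : j ≠ k) :
    |A' m j| / √|A' j j| ≤
      |A m j| / √|A j j| + 1 / g * (|A m k| / √|A k k|) * |scaled A k j| := by
  have ht := hA.sqrt_pos k
  have hu := hA.sqrt_pos j
  have hg := hA.gap_pos
  have ht2 : √|A k k| ^ 2 = |A k k| := Real.sq_sqrt (abs_nonneg _)
  have hsin := hR.sin_mul_le hA hmk
  have hc1 : |c| ≤ 1 := by
    rw [← sq_le_one_iff_abs_le_one]; linarith [sq_nonneg s, hR.sq_add_sq]
  have h1 : |s| * √|A k k| ≤ 1 / g * (|A m k| / √|A k k|) := by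
    rw [div_mul_div_comm, le_div_iff₀ (by positivity)]
    have : 0 ≤ |s| * g * |A m m| := by positivity
    have e : |s| * √|A k k| * (g * √|A k k|) = |s| * g * |A k k| := by
      linear_combination |s| * g * ht2
    linarith
  rw [hR.rest j j hjm hjk hjm hjk, hR.row_m j hjm hjk, div_add' _ _ _ hu.ne',
    div_le_div_iff_of_pos_right hu]
  refine (abs_add_le _ _).trans (add_le_add ?_ ?_)
  · rw [abs_mul]; exact mul_le_of_le_one_left (abs_nonneg _) hc1
  · rw [abs_mul, hA.abs_eq k j]
    have := mul_le_mul_of_nonneg_right h1 (by positivity : 0 ≤ |scaled A k j| * √|A j j|)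
    linarith

/-- The weight of row k changes in this step, whence the factor 1.01. The sine is now taken against
√|a_mm|, which leaves 1/(g√|a_mm|) in front of the second-order term. -/
lemma IsRotated.abs_scaled_row_k_le (hR : IsRotated m k A A' c s c' s' e)
    (hA : IsSeparated A g β) (hmk : m ≠ k) {j : Fin n} (hjm : j ≠ m) (hjk : j ≠ k) :
    |scaled A' k j| ≤ 1.01 * (|scaled A k j| +
      1 / (g * √|A m m|) * (|A m k| / √|A k k|) * |scaled A m j|) := by
  have hr := hA.sqrt_pos m
  have ht := hA.sqrt_pos k
  have hu := hA.sqrt_pos j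
  have hg := hA.gap_pos
  have hr2 : √|A m m| ^ 2 = |A m m| := Real.sq_sqrt (abs_nonneg _)
  have ht2 : √|A k k| ^ 2 = |A k k| := Real.sq_sqrt (abs_nonneg _)
  have hsin := hR.sin_mul_le hA hmk
  have ht' : √|A k k| ≤ 1.01 * √|A' k k| := by
    refine Real.sqrt_le_iff.2 ⟨by positivity, ?_⟩
    rw [mul_pow, Real.sq_sqrt (abs_nonneg _)]
    have h1 := (hR.le_abs_diag hA hmk).2
    have h2 := hA.eps_le hmk
    have h3 := hA.le_one
    nlinarith [abs_nonneg (A k k)]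
  have ht'0 : 0 < √|A' k k| := by linarith
  have hc1 : |c'| ≤ 1 := by
    rw [← sq_le_one_iff_abs_le_one, hR.cos_sq]; linarith [sq_nonneg s, hR.sq_add_sq]
  have hs : |s'| = |s| := (sq_eq_sq_iff_abs_eq_abs _ _).1 hR.sin_sq
  have h1 : |s| * √|A m m| ≤ 1 / (g * √|A m m|) * |A m k| := by
    rw [div_mul_eq_mul_div, le_div_iff₀ (by positivity)]
    have : 0 ≤ |s| * g * |A k k| := by positivity
    have e : |s| * √|A m m| * (g * √|A m m|) = |s| * g * |A m m| := by
      linear_combination |s| * g * hr2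
    linarith
  have h2 : |A' k j| ≤ √|A k k| * √|A j j| * (|scaled A k j| +
      1 / (g * √|A m m|) * (|A m k| / √|A k k|) * |scaled A m j|) := by
    rw [hR.row_k j hjm hjk]
    refine (abs_add_le _ _).trans ?_
    rw [mul_add]
    refine add_le_add ?_ ?_
    · rw [abs_mul, hA.abs_eq k j]
      exact (mul_le_of_le_one_left (by positivity) hc1).trans_eq (by ring)
    · rw [abs_mul, hs, hA.abs_eq m j]
      have := mul_le_mul_of_nonneg_right h1 (by positivity : 0 ≤ |scaled A m j| * √|A j j|)
      refine (le_of_eq ?_).trans (this.trans_eq ?_)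
      · ring
      · field_simp
  have h3 : 0 ≤ |scaled A k j| +
      1 / (g * √|A m m|) * (|A m k| / √|A k k|) * |scaled A m j| := by positivity
  generalize |scaled A k j| +
      1 / (g * √|A m m|) * (|A m k| / √|A k k|) * |scaled A m j| = w at *
  rw [scaled_apply, hR.rest j j hjm hjk hjm hjk, abs_mul, abs_mul,
    abs_of_pos (inv_pos.2 ht'0), abs_of_pos (inv_pos.2 hu), inv_mul_eq_div, ← div_eq_mul_inv,
    div_div, div_le_iff₀ (by positivity)]
  refine h2.trans ?_
  have := mul_le_mul_of_nonneg_right ht' (by positivity : 0 ≤ √|A j j| * w)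
  linarith

end Rotated

/-! ### The order of the pivots, and the diagonal case. -/

lemma pivot_ne {n : ℕ} (m : Fin n) {t : ℕ} (ht : t < n - 1) : pivot m t ≠ m := by
  have := m.isLt
  intro h
  have h' := congrArg Fin.val h
  simp only [pivot] at h'
  split_ifs at h' <;> omega

lemma pivot_injOn {n : ℕ} (m : Fin n) {t u : ℕ} (ht : t < n - 1) (hu : u < n - 1)
    (h : pivot m t = pivot m u) : t = u := by
  have := m.isLt
  have h' := congrArg Fin.val h
  simp only [pivot] at h'
  split_ifs at h' <;> omega

lemma exists_pivot_eq {n : ℕ} {m i : Fin n} (hi : i ≠ m) : ∃ t < n - 1, pivot m t = i := by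
  have h1 := m.isLt
  have h2 := i.isLt
  have h3 : (i : ℕ) ≠ m := fun h => hi (Fin.ext h)
  rcases lt_or_gt_of_ne h3 with h | h
  · exact ⟨i, by omega, by simp [pivot, h]⟩
  · refine ⟨n - 1 - i + m, by omega, ?_⟩
    ext
    simp only [pivot]
    rw [if_neg (by omega)]
    omega

/-- A cycle visits every index other than m exactly once; the estimates use nothing else about the
order. -/
lemma sum_pivot {n : ℕ} (m : Fin n) (f : Fin n → ℝ) :
    ∑ t ∈ Finset.range (n - 1), f (pivot m t) = ∑ j with j ≠ m, f j := by
  refine Finset.sum_nbij (pivot m) ?_ ?_ ?_ fun _ _ => rfl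
  · intro t ht
    simpa using pivot_ne m (Finset.mem_range.1 ht)
  · intro t ht u hu h
    exact pivot_injOn m (by simpa using ht) (by simpa using hu) h
  · intro i hi
    obtain ⟨t, ht, rfl⟩ := exists_pivot_eq (by simpa using hi : i ≠ m)
    exact ⟨t, by simpa using ht, rfl⟩

lemma sortDiag_of_monotone {n : ℕ} {A : Matrix (Fin n) (Fin n) ℝ}
    (h : Monotone fun i => A i i) : sortDiag A = A := by
  rw [sortDiag, Tuple.sort_eq_refl_iff_monotone.2 h]
  rfl

lemma offRow_sq {n : ℕ} (A : Matrix (Fin n) (Fin n) ℝ) (m : Fin n) :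
    offRow A m ^ 2 = ∑ j with j ≠ m, A m j ^ 2 :=
  Real.sq_sqrt (Finset.sum_nonneg fun _ _ => sq_nonneg _)

lemma IsRotated.eq_of_diagonal {n : ℕ} {m k : Fin n} {A A' : Matrix (Fin n) (Fin n) ℝ}
    {c s c' s' e : ℝ} (hR : IsRotated m k A A' c s c' s' e) (hmk : m ≠ k)
    (hA : ∀ i j, i ≠ j → A i j = 0) : A' = A := by
  have he := hR.shift_eq_zero (hA m k hmk)
  have hd := hR.abs_diag_sub hmk
  rw [he, abs_eq_zero, abs_eq_zero, sub_eq_zero, sub_eq_zero] at hd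
  have hm : ∀ j, A' m j = A m j := fun j => by
    by_cases hjm : j = m
    · subst hjm; exact hd.1
    by_cases hjk : j = k
    · subst hjk; rw [hR.pivot_eq_zero, hA m j hmk]
    rw [hR.row_m j hjm hjk, hA m j (Ne.symm hjm), hA k j (Ne.symm hjk)]; ring
  have hk : ∀ j, A' k j = A k j := fun j => by
    by_cases hjm : j = m
    · subst hjm; rw [hR.symm, hR.pivot_eq_zero, hA k j hmk.symm]
    by_cases hjk : j = k
    · subst hjk; exact hd.2
    rw [hR.row_k j hjm hjk, hA m j (Ne.symm hjm), hA k j (Ne.symm hjk)]; ring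
  have hsymm : ∀ i j, A i j = A j i := fun i j => by
    by_cases h : i = j
    · rw [h]
    · rw [hA i j h, hA j i (Ne.symm h)]
  ext i j
  by_cases him : i = m
  · rw [him, hm]
  by_cases hik : i = k
  · rw [hik, hk]
  by_cases hjm : j = m
  · rw [hjm, hR.symm, hm, hsymm]
  by_cases hjk : j = k
  · rw [hjk, hR.symm, hk, hsymm]
  exact hR.rest i j him hik hjm hjk

/-- A run started from a sorted diagonal matrix is stationary. -/
lemma IsRun.eq_of_diagonal {n L : ℕ} {m : Fin n} {A : Matrix (Fin n) (Fin n) ℝ}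
    {X : ℕ → Matrix (Fin n) (Fin n) ℝ} (hX : IsRun 0 m A L X) (hn : 2 ≤ n)
    (hsorted : Monotone fun i => A i i) (hA : ∀ i j, i ≠ j → A i j = 0) :
    ∀ k ≤ L * (n - 1), X k = A := by
  intro k
  induction k with
  | zero => intro _; rw [hX.1, sortDiag_of_monotone hsorted]
  | succ k ih =>
    intro hk
    have hstep := hX.2 k (by omega)
    rw [ih (by omega)] at hstep
    have hp : pivot m (k % (n - 1)) ≠ m := pivot_ne m (Nat.mod_lt _ (by omega))
    have hsymm : ∀ i j, A i j = A j i := fun i j => by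
      by_cases h : i = j
      · rw [h]
      · rw [hA i j h, hA j i (Ne.symm h)]
    obtain ⟨c, s, c', s', e, hR⟩ := hstep.exists_isRotated hp hsymm
      (fun h => hsorted h.le) (fun h => hsorted h.le)
    exact hR.eq_of_diagonal hp.symm hA

lemma eq_zero_of_off_scaled_eq_zero {n : ℕ} {A : Matrix (Fin n) (Fin n) ℝ}
    (hd : ∀ i, A i i ≠ 0) (h : off (scaled A) = 0) {i j : Fin n} (hij : i ≠ j) : A i j = 0 := by
  have h0 : offSq (scaled A) = 0 := by rw [← off_sq, h]; ring
  have h1 := (Finset.sum_eq_zero_iff_of_nonneg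
    fun _ _ => Finset.sum_nonneg fun _ _ => sq_nonneg _).1 h0 i (Finset.mem_univ i)
  have h2 := (Finset.sum_eq_zero_iff_of_nonneg fun _ _ => sq_nonneg _).1 h1 j
    (by simpa using hij.symm)
  rw [eq_mul_scaled hd i j, pow_eq_zero_iff two_ne_zero |>.1 h2]
  ring

/-! ### Invariants along the run. -/

/-- The matrix `A` is orthogonally similar to `A₀`, has a nonzero diagonal whose entry `m` is
in its sorted place, and the square of its scaled off-diagonal norm is at most `B`. -/
structure IsReached {n : ℕ} {A₀ : Matrix (Fin n) (Fin n) ℝ} (hA₀ : A₀.IsHermitian) (m : Fin n)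
    (B : ℝ) (A : Matrix (Fin n) (Fin n) ℝ) : Prop where
  similar : ∃ V : Matrix (Fin n) (Fin n) ℝ, Vᵀ * V = 1 ∧
    A = Vᵀ * Matrix.diagonal hA₀.eigenvalues * V
  diag_ne : ∀ i, A i i ≠ 0
  diag_lt : ∀ i < m, A i i < A m m
  lt_diag : ∀ i, m < i → A m m < A i i
  offSq_le : offSq (scaled A) ≤ B

section Run

variable {n : ℕ} {A : Matrix (Fin n) (Fin n) ℝ} {hA : A.IsHermitian} {m : Fin n} {β : ℝ}
  {C : Matrix (Fin n) (Fin n) ℝ}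

/-- The bounds β ≤ 1/32 and β ≤ 0.091γ give γ(1 − β) − β ≥ 0.87γ; note 1.001/11 = 0.091. -/
lemma isSeparated_of_similar (hsim : ∃ V : Matrix (Fin n) (Fin n) ℝ, Vᵀ * V = 1 ∧
    C = Vᵀ * Matrix.diagonal hA.eigenvalues * V) (hd : ∀ i, C i i ≠ 0)
    (hoff : offSq (scaled C) ≤ β ^ 2) (hβ : 0 < β) (hβ1 : 32 * β ≤ 1)
    (hβγ : β ≤ 0.091 * relGap hA) : IsSeparated C (0.87 * relGap hA) β := by
  obtain ⟨V, hV, hC⟩ := hsim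
  have hγ : 0 < relGap hA := by linarith
  refine ⟨?_, hd, by linarith, ?_, hβ.le, hoff, by linarith, hβ1⟩
  · have : Cᵀ = C := by
      rw [hC]; simp [Matrix.transpose_mul, Matrix.mul_assoc]
    intro i j
    exact congrFun (congrFun this j) i
  · intro i j hij
    have hoff' : off (scaled C) ≤ β := by
      rw [← off_sq] at hoff
      exact le_of_sq_le_sq hoff hβ.le
    refine le_trans ?_ (gap_diag hA hd hV hC hoff' (by linarith) hγ.le hij)
    refine mul_le_mul_of_nonneg_right ?_ (by positivity)
    have := mul_le_mul_of_nonneg_left hβ1 hγ.le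
    linarith

lemma IsReached.isSeparated {B : ℝ} (hC : IsReached hA m B C) (hB : B ≤ β ^ 2) (hβ : 0 < β)
    (hβ1 : 32 * β ≤ 1) (hβγ : β ≤ 0.091 * relGap hA) :
    IsSeparated C (0.87 * relGap hA) β :=
  isSeparated_of_similar hC.similar hC.diag_ne (hC.offSq_le.trans hB) hβ hβ1 hβγ

lemma IsReached.isRotated {B : ℝ} (hC : IsReached hA m B C) {k : Fin n} (hk : k ≠ m)
    {C' : Matrix (Fin n) (Fin n) ℝ} (hstep : Step 0 m k C C') (hsymm : ∀ i j, C i j = C j i) :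
    ∃ c s c' s' e, IsRotated m k C C' c s c' s' e :=
  hstep.exists_isRotated hk hsymm (fun h => (hC.diag_lt k h).le) (fun h => (hC.lt_diag k h).le)

variable {X : ℕ → Matrix (Fin n) (Fin n) ℝ} {α : ℝ} {L : ℕ}

lemma IsRun.isReached (hX : IsRun 0 m A L X) (hn : 2 ≤ n) (hsorted : Monotone fun i => A i i)
    (hdiag : ∀ i, A i i ≠ 0) (hα : 0 < α) (hαA : offSq (scaled A) ≤ α ^ 2)
    (hα1 : 33 * α ≤ 1) (hαγ : 11 * α ≤ relGap hA) (hL : (L * (n - 1) : ℕ) * α ^ 2 ≤ 1 / 121) :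
    ∀ k ≤ L * (n - 1), IsReached hA m (α ^ 2 + k * (0.21 * (α ^ 2) ^ 2)) (X k) := by
  -- Growth budget: each step adds at most 0.21α⁴, and 0.21/121 is below 1.001² − 1.
  have hB (k : ℕ) (hk : k ≤ L * (n - 1)) :
      α ^ 2 + k * (0.21 * (α ^ 2) ^ 2) ≤ (1.001 * α) ^ 2 := by
    have h1 : (k : ℝ) * α ^ 2 ≤ 1 / 121 :=
      (mul_le_mul_of_nonneg_right (Nat.cast_le.2 hk) (sq_nonneg α)).trans hL
    have h2 := mul_le_mul_of_nonneg_right h1 (sq_nonneg α)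
    linarith [sq_nonneg α]
  have hβ : 0 < 1.001 * α := by linarith
  have hβ1 : 32 * (1.001 * α) ≤ 1 := by linarith
  have hβγ : 1.001 * α ≤ 0.091 * relGap hA := by linarith
  intro k
  induction k with
  | zero =>
    intro hk
    rw [hX.1, sortDiag_of_monotone hsorted]
    have hsim := exists_diagonalization hA
    have hsep := isSeparated_of_similar hsim hdiag
      (hαA.trans ((le_add_of_nonneg_right (by positivity)).trans (hB 0 hk))) hβ hβ1 hβγ
    have hne (i j : Fin n) (hij : i ≠ j) : A i i ≠ A j j := fun h => by
      have h1 := hsep.gap i j hij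
      rw [h, sub_self, abs_zero] at h1
      have h2 := abs_pos.2 (hdiag j)
      have h3 := mul_pos hsep.gap_pos (add_pos h2 h2)
      linarith
    refine ⟨hsim, hdiag, fun i hi => (hsorted hi.le).lt_of_ne (hne i m hi.ne),
      fun i hi => (hsorted hi.le).lt_of_ne (hne m i hi.ne), by simpa using hαA⟩
  | succ k ih =>
    intro hk
    have hC := ih (by omega)
    have hBk := hB k (by omega)
    have hsep := hC.isSeparated hBk hβ hβ1 hβγ
    have hp : pivot m (k % (n - 1)) ≠ m := pivot_ne m (Nat.mod_lt _ (by omega))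
    obtain ⟨c, s, c', s', e, hR⟩ := hC.isRotated hp (hX.2 k (by omega)) hsep.symm
    obtain ⟨hlt, hgt⟩ := hR.lt_diag_of_lt hsep hp.symm hC.diag_lt hC.lt_diag
    refine ⟨?_, hR.diag_ne_zero hsep hp.symm, hlt, hgt, ?_⟩
    · obtain ⟨V, hV, hXV⟩ := hC.similar
      obtain ⟨Q, hQ, hXQ⟩ := hR.similar
      refine ⟨V * Q, ?_, ?_⟩
      · rw [Matrix.transpose_mul, Matrix.mul_assoc, ← Matrix.mul_assoc Vᵀ, hV, Matrix.one_mul, hQ]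
      · rw [hXQ, hXV]
        simp only [Matrix.transpose_mul, Matrix.mul_assoc]
    · have h1 := hR.offSq_scaled_le hsep hp.symm
      have h2 := hC.offSq_le
      have h3 := pow_le_pow_left₀ (offSq_nonneg _) (h2.trans hBk) 2
      push_cast
      have : 0 ≤ (α ^ 2) ^ 2 := by positivity
      linarith

/-! ### Contraction of row m in one cycle. -/

/-- A sweep of rotations, each annihilating an entry of the row `m`, reduces the scaled norm
of that row by a factor of the order of `β / g`. -/
lemma offRow_sweep_le {g : ℝ} (hn : 2 ≤ n) (hβn : 15 * n * β ≤ 2)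
    (hsep : ∀ t ≤ n - 1, IsSeparated (X t) g β)
    (hrot : ∀ t < n - 1, ∃ c s c' s' e, IsRotated m (pivot m t) (X t) (X (t + 1)) c s c' s' e) :
    offRow (scaled (X (n - 1))) m ≤ 2.4 * β / g * offRow (scaled (X 0)) m := by
  have hg := (hsep 0 (by omega)).gap_pos
  have hβ0 := (hsep 0 (by omega)).nonneg
  have hβg := (hsep 0 (by omega)).le_gap
  set a := |X 0 m m| with ha
  have ha0 : 0 < a := abs_pos.2 ((hsep 0 (by omega)).diag_ne m)
  -- Each step shrinks |a_mm| by at most the factor 1 − β/18; Bernoulli's inequality and nβ ≤ 2/15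
  -- limit the total loss to one percent.
  have hdiag : ∀ t ≤ n - 1, 0.99 * a ≤ |X t m m| := by
    have hδ : ∀ t ≤ n - 1, (1 + -(β / 18)) ^ t * a ≤ |X t m m| := by
      intro t
      induction t with
      | zero => intro _; simp [ha]
      | succ t ih =>
        intro ht
        obtain ⟨c, s, c', s', e, hR⟩ := hrot t (by omega)
        have hs := hsep t (by omega)
        have hp := (pivot_ne m (by omega : t < n - 1)).symm
        have h1 := (hR.le_abs_diag hs hp).1
        have h2 := hs.eps_le hp
        have h3 := mul_le_mul_of_nonneg_left (ih (by omega))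
          (by linarith [hs.le_one] : 0 ≤ 1 + -(β / 18))
        have h4 := mul_le_mul_of_nonneg_right h2 (abs_nonneg (X t m m))
        rw [pow_succ]
        linarith
    intro t ht
    have h1 := one_add_mul_le_pow (by linarith [(hsep 0 (by omega)).le_one] : -2 ≤ -(β / 18)) t
    have h2 : (t : ℝ) * β ≤ n * β :=
      mul_le_mul_of_nonneg_right (Nat.cast_le.2 (by omega)) hβ0
    have h3 := mul_le_mul_of_nonneg_right h1 ha0.le
    have h4 : 0.99 * a ≤ (1 + t * -(β / 18)) * a :=
      mul_le_mul_of_nonneg_right (by linarith) ha0.le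
    exact h4.trans (h3.trans (hδ t ht))
  set κ := pivot m with hκ
  have hκne : ∀ t < n - 1, κ t ≠ m := fun t ht => pivot_ne m ht
  have hκinj : ∀ t < n - 1, ∀ u < n - 1, t ≠ u → κ t ≠ κ u :=
    fun t ht u hu htu h => htu (pivot_injOn m ht hu h)
  have hrow : ∀ t ≤ n - 1, ∑ j ∈ Finset.range (n - 1),
      (|X t m (κ j)| / √|X t (κ j) (κ j)|) ^ 2 = |X t m m| * offRow (scaled (X t)) m ^ 2 := by
    intro t ht
    rw [sum_pivot m (fun j => (|X t m j| / √|X t j j|) ^ 2), offRow_sq, Finset.mul_sum]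
    refine Finset.sum_congr rfl fun j _ => ?_
    rw [(hsep t ht).abs_eq m j, mul_div_cancel_right₀ _ ((hsep t ht).sqrt_pos j).ne', mul_pow,
      Real.sq_sqrt (abs_nonneg _), sq_abs]
  have hE : ∑ t ∈ Finset.range (n - 1), ∑ j ∈ Finset.range (n - 1),
      (if t < j then |scaled (X 0) (κ t) (κ j)| else 0) ^ 2 ≤ β ^ 2 := by
    refine le_trans ?_ (hsep 0 (by omega)).offSq_le
    calc _ ≤ ∑ t ∈ Finset.range (n - 1), ∑ j with j ≠ κ t, scaled (X 0) (κ t) j ^ 2 := by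
          refine Finset.sum_le_sum fun t ht => ?_
          rw [Finset.sum_filter]
          refine le_trans ?_ (Finset.sum_le_sum_of_subset_of_nonneg
            (Finset.filter_subset (fun j => j ≠ m) _) fun _ _ _ => by split_ifs <;> positivity)
          rw [← sum_pivot m]
          refine Finset.sum_le_sum fun j hj => ?_
          split_ifs with h1 h2
          · rw [sq_abs]
          · exact absurd h2 (not_not.2 (hκinj j (Finset.mem_range.1 hj) t (Finset.mem_range.1 ht)
              h1.ne'))
          · rw [zero_pow two_ne_zero]; positivity
          · simp
      _ = ∑ i with i ≠ m, ∑ j with j ≠ i, scaled (X 0) i j ^ 2 :=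
          sum_pivot m (fun i => ∑ j with j ≠ i, scaled (X 0) i j ^ 2)
      _ ≤ _ := Finset.sum_le_sum_of_subset_of_nonneg (Finset.filter_subset _ _)
          fun _ _ _ => Finset.sum_nonneg fun _ _ => sq_nonneg _
  have hM : ∀ t ≤ n - 1, ∑ j ∈ Finset.range (n - 1), |scaled (X t) m (κ j)| ^ 2 ≤ β ^ 2 / 2 := by
    intro t ht
    simp only [sq_abs]
    rw [sum_pivot m (fun j => scaled (X t) m j ^ 2)]
    exact (sum_row_sq_le (pivot_ne m (by omega : 0 < n - 1)).symm
      (scaled_symm (hsep t ht).symm)).trans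
      (div_le_div_of_nonneg_right (hsep t ht).offSq_le two_pos.le)
  obtain ⟨Q, hQ0, hQ1, hQ2⟩ := sweep_bound (N := n - 1) (θ := 1 / g) (ρ := 1.01)
    (v := 1 / (g * √(0.99 * a))) (E := β ^ 2) (M := β ^ 2 / 2)
    (Y := fun t j => |X t m (κ j)| / √|X t (κ j) (κ j)|)
    (Z := fun t j => |scaled (X t) m (κ j)|)
    (H := fun t i j => |scaled (X t) (κ i) (κ j)|)
    (by positivity) (by norm_num) (fun _ _ => by positivity) (fun _ _ _ => by positivity)
    (fun t ht => by
      obtain ⟨c, s, c', s', e, hR⟩ := hrot t ht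
      rw [hR.pivot_eq_zero, abs_zero, zero_div])
    (fun t ht j hj hjt => by
      obtain ⟨c, s, c', s', e, hR⟩ := hrot t ht
      exact hR.abs_row_m_le (hsep t ht.le) (hκne t ht).symm (hκne j hj) (hκinj j hj t ht hjt))
    (fun t ht i hi j hj hit hjt => by
      obtain ⟨c, s, c', s', e, hR⟩ := hrot t ht
      exact congrArg abs (hR.scaled_rest (hκne i hi) (hκinj i hi t ht hit) (hκne j hj)
        (hκinj j hj t ht hjt)))
    (fun t ht j hj hjt => by
      obtain ⟨c, s, c', s', e, hR⟩ := hrot t ht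
      have h1 := hR.abs_scaled_row_k_le (hsep t ht.le) (hκne t ht).symm (hκne j hj)
        (hκinj j hj t ht hjt)
      have h2 : 1 / (g * √|X t m m|) ≤ 1 / (g * √(0.99 * a)) :=
        one_div_le_one_div_of_le (by positivity)
          (mul_le_mul_of_nonneg_left (Real.sqrt_le_sqrt (hdiag t ht.le)) hg.le)
      change |scaled (X (t + 1)) (κ j) (κ t)| ≤ _
      rw [scaled_symm hR.symm]
      refine h1.trans (mul_le_mul_of_nonneg_left (add_le_add_right ?_ _) (by norm_num))
      exact mul_le_mul_of_nonneg_right (mul_le_mul_of_nonneg_right h2 (by positivity))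
        (abs_nonneg _))
    hE (fun t ht => hM t ht.le) (by positivity) (fun _ _ => by positivity)
  rw [hrow 0 (by omega)] at hQ1
  rw [hrow (n - 1) le_rfl] at hQ2
  have hR0 : offRow (scaled (X 0)) m ^ 2 ≤ β ^ 2 / 2 := by
    have := hM 0 (by omega)
    simp only [sq_abs] at this
    rwa [sum_pivot m (fun j => scaled (X 0) m j ^ 2), ← offRow_sq] at this
  have hdN := hdiag (n - 1) le_rfl
  have hx0 : 0 ≤ offRow (scaled (X 0)) m := Real.sqrt_nonneg _
  generalize offRow (scaled (X 0)) m = x at *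
  generalize offRow (scaled (X (n - 1))) m = y at *
  generalize |X (n - 1) m m| = b at *
  have hv : (1 / (g * √(0.99 * a))) ^ 2 = 1 / (g ^ 2 * (0.99 * a)) := by
    rw [div_pow, mul_pow, Real.sq_sqrt (by positivity), one_pow]
  rw [hv] at hQ2
  obtain ⟨w, hw⟩ : ∃ w, w = β / g := ⟨_, rfl⟩
  have hw0 : 0 ≤ w := by rw [hw]; positivity
  have hw1 : w ≤ 1 / 9 := by rw [hw, div_le_div_iff₀ hg (by norm_num)]; linarith
  have hβw : β = w * g := by rw [hw]; field_simp
  have hw2 : w ^ 2 ≤ 1 / 81 := by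
    have := pow_le_pow_left₀ hw0 hw1 2
    norm_num at this ⊢; exact this
  -- With w = β/g ≤ 1/9, the coefficient is 2/(1 − 2w²) ≤ 162/79 < 2.06.
  have hQ3 : Q ≤ 2.06 * (a * x ^ 2) := by
    have h1 : (1 / g) ^ 2 * β ^ 2 = w ^ 2 := by rw [hβw]; field_simp
    rw [mul_assoc 2, h1] at hQ1
    have h2 := mul_le_mul_of_nonneg_left hw2 hQ0
    change _ ≤ 2 * (a * x ^ 2) at hQ1
    linarith
  have hQ4 : Q ≤ 2.06 * a * (β ^ 2 / 2) := by
    have := mul_le_mul_of_nonneg_left hR0 (by positivity : 0 ≤ 2.06 * a)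
    linarith
  have h5 : 1 / (g ^ 2 * (0.99 * a)) * Q ≤ 1 / 50 := by
    rw [div_mul_eq_mul_div, one_mul, div_le_iff₀ (by positivity)]
    refine hQ4.trans ?_
    rw [hβw, mul_pow]
    have hag : 0 ≤ a * g ^ 2 := by positivity
    have := mul_le_mul_of_nonneg_right hw2 hag
    linarith
  have h6 : β ^ 2 + 1 / (g ^ 2 * (0.99 * a)) * Q * (β ^ 2 / 2) ≤ 1.01 * β ^ 2 := by
    have := mul_le_mul_of_nonneg_right h5 (by positivity : 0 ≤ β ^ 2 / 2)
    linarith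
  have h7 : b * y ^ 2 ≤ 2 * (1 / g) ^ 2 * 1.01 ^ 2 * (2.06 * (a * x ^ 2)) * (1.01 * β ^ 2) :=
    hQ2.trans (mul_le_mul (mul_le_mul_of_nonneg_left hQ3 (by positivity)) h6
      (by positivity) (by positivity))
  have h8 : 0.99 * a * y ^ 2 ≤ b * y ^ 2 := mul_le_mul_of_nonneg_right hdN (sq_nonneg y)
  have h9 : 2 * (1 / g) ^ 2 * 1.01 ^ 2 * (2.06 * (a * x ^ 2)) * (1.01 * β ^ 2) =
      2 * 1.01 ^ 2 * 2.06 * 1.01 * a * (x ^ 2 * w ^ 2) := by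
    rw [hβw]; field_simp
  -- The accumulated constant 2·1.01²·2.06·1.01/0.99 is about 4.29, below 2.4² = 5.76.
  have h10 : a * y ^ 2 ≤ a * (2.4 * w * x) ^ 2 := by
    have : 0 ≤ a * (x ^ 2 * w ^ 2) := by positivity
    linarith
  have h11 := le_of_mul_le_mul_left h10 ha0
  have h12 : 2.4 * β / g * x = 2.4 * w * x := by rw [hw]; ring
  rw [h12]
  exact le_of_sq_le_sq h11 (by positivity)

end Run

end PartialJacobi

/-! ### Assembling the two estimates. -/

theorem theorem2 (n : ℕ) (hn : 3 ≤ n) (A : Matrix (Fin n) (Fin n) ℝ) (hA : A.IsHermitian)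
    (hsorted : Monotone fun i => A i i) (hdiag : ∀ i, A i i ≠ 0)
    (hsmall : PartialJacobi.off (PartialJacobi.scaled A) ≤
      1 / 11 * min (1 / (n : ℝ)) (PartialJacobi.relGap hA))
    (m : Fin n) (X : ℕ → Matrix (Fin n) (Fin n) ℝ) (hX : PartialJacobi.IsRun 0 m A n X) :
    (∀ k ≤ n * (n - 1),
      (∀ i, X k i i ≠ 0) ∧
      PartialJacobi.off (PartialJacobi.scaled (X k)) ≤
        1.001 * PartialJacobi.off (PartialJacobi.scaled A)) ∧
    (∀ l : ℕ, 1 ≤ l → l ≤ n →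
      PartialJacobi.offRow (PartialJacobi.scaled (X ((n - 1) * l))) m ≤
        (2.8 * 1.001 * PartialJacobi.off (PartialJacobi.scaled A) / PartialJacobi.relGap hA) ^ l *
          PartialJacobi.off (PartialJacobi.scaled A)) := by
  open PartialJacobi in
  have hα0 : 0 ≤ off (scaled A) := Real.sqrt_nonneg _
  have hsymm : ∀ i j, A i j = A j i := fun i j => by simpa using hA.apply j i
  have hrow0 : offRow (scaled A) m ≤ off (scaled A) := by
    refine le_of_sq_le_sq ?_ hα0
    rw [offRow_sq, off_sq]
    exact (sum_row_sq_le (pivot_ne m (by omega : 0 < n - 1)).symm (scaled_symm hsymm)).trans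
      (half_le_self (offSq_nonneg _))
  -- For α₀ = 0 the gap may vanish and no separation is available, but then the matrix is diagonal
  -- and the run stationary.
  rcases hα0.eq_or_lt' with hα | hα
  · have hXA := hX.eq_of_diagonal (by omega) hsorted
      fun i j hij => eq_zero_of_off_scaled_eq_zero hdiag hα hij
    refine ⟨fun k hk => ?_, fun l _ hl => ?_⟩
    · rw [hXA k hk]
      exact ⟨hdiag, by linarith⟩
    · rw [hXA _ (by rw [mul_comm]; exact Nat.mul_le_mul_right _ hl), hα, mul_zero]
      exact hrow0.trans hα.le
  have hn0 : (3 : ℝ) ≤ n := by exact_mod_cast hn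
  have h1 : off (scaled A) ≤ 1 / 11 * (1 / (n : ℝ)) :=
    hsmall.trans (mul_le_mul_of_nonneg_left (min_le_left _ _) (by norm_num))
  have hαγ : 11 * off (scaled A) ≤ relGap hA := by
    have := hsmall.trans (mul_le_mul_of_nonneg_left (min_le_right _ _) (by norm_num))
    linarith
  have hαn : n * off (scaled A) ≤ 1 / 11 := by
    have := mul_le_mul_of_nonneg_left h1 (by linarith : (0 : ℝ) ≤ n)
    refine this.trans_eq ?_
    field_simp
  have hα1 : 33 * off (scaled A) ≤ 1 := by
    have := mul_le_mul_of_nonneg_right hn0 hα0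
    linarith
  have hL : (n * (n - 1) : ℕ) * off (scaled A) ^ 2 ≤ 1 / 121 := by
    have h2 : ((n * (n - 1) : ℕ) : ℝ) ≤ n * n := by
      exact_mod_cast Nat.mul_le_mul_left n (Nat.sub_le n 1)
    have h3 := mul_le_mul_of_nonneg_right h2 (sq_nonneg (off (scaled A)))
    have h4 := pow_le_pow_left₀ (by positivity) hαn 2
    norm_num at h4
    linarith
  have hreach := hX.isReached (by omega) hsorted hdiag hα (off_sq _).ge hα1 hαγ hL
  have hB (k : ℕ) (hk : k ≤ n * (n - 1)) :
      off (scaled A) ^ 2 + k * (0.21 * (off (scaled A) ^ 2) ^ 2) ≤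
        (1.001 * off (scaled A)) ^ 2 := by
    have h2 := (mul_le_mul_of_nonneg_right (Nat.cast_le.2 hk : (k : ℝ) ≤ _)
      (sq_nonneg (off (scaled A)))).trans hL
    have h3 := mul_le_mul_of_nonneg_right h2 (sq_nonneg (off (scaled A)))
    linarith [sq_nonneg (off (scaled A))]
  have hsep (k : ℕ) (hk : k ≤ n * (n - 1)) :=
    (hreach k hk).isSeparated (hB k hk) (by linarith) (by linarith) (by linarith)
  refine ⟨fun k hk => ⟨(hreach k hk).diag_ne, ?_⟩, ?_⟩
  · refine le_of_sq_le_sq ?_ (by linarith)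
    rw [off_sq]
    exact (hsep k hk).offSq_le
  have hγ : 0 < relGap hA := by linarith
  have hcycle : ∀ l < n, offRow (scaled (X ((n - 1) * (l + 1)))) m ≤
      2.8 * 1.001 * off (scaled A) / relGap hA * offRow (scaled (X ((n - 1) * l))) m := by
    intro l hl
    have hle (t : ℕ) (ht : t ≤ n - 1) : (n - 1) * l + t ≤ n * (n - 1) :=
      calc (n - 1) * l + t ≤ (n - 1) * (l + 1) := by rw [mul_add, mul_one]; omega
        _ ≤ (n - 1) * n := Nat.mul_le_mul_left _ hl
        _ = _ := mul_comm _ _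
    have h := offRow_sweep_le (X := fun t => X ((n - 1) * l + t)) (m := m) (by omega)
      (by linarith) (fun t ht => hsep _ (hle t ht)) fun t ht => by
        have hs := hle (t + 1) ht
        have hstep := hX.2 ((n - 1) * l + t) (by omega)
        rw [Nat.mul_add_mod, Nat.mod_eq_of_lt ht] at hstep
        exact (hreach _ (hle t ht.le)).isRotated (pivot_ne m ht) hstep (hsep _ (hle t ht.le)).symm
    refine h.trans (mul_le_mul_of_nonneg_right ?_ (Real.sqrt_nonneg _))
    -- The sweep factor has g = 0.87γ in its denominator, and 2.4/0.87 < 2.8.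
    rw [div_le_div_iff₀ (by linarith) hγ]
    have := mul_pos hα hγ
    linarith
  intro l hl1 hl
  clear hl1
  induction l with
  | zero =>
    rw [mul_zero, pow_zero, one_mul, hX.1, sortDiag_of_monotone hsorted]
    exact hrow0
  | succ l ih =>
    refine (hcycle l hl).trans ?_
    have hq : 0 ≤ 2.8 * 1.001 * off (scaled A) / relGap hA := div_nonneg (by linarith) hγ.le
    exact (mul_le_mul_of_nonneg_left (ih (by omega)) hq).trans_eq (by rw [pow_succ']; ring)
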